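/- Let $\mathbb F_\beta=\mathbb R,\mathbb C,\mathbb H$ (real quaternions) for $\beta=1,2,4$ respectively, let $n\ge N\ge 0$ be integers, and let $\mathcal M^\beta_{n\times N}$ be the set of $n\times N$ matrices over $\mathbb F_\beta$, with $(\mathrm dM)$ the Lebesgue measure given by the product of the $\beta nN$ independent real differentials of the entries. Let $\mathcal V^\beta_{N,n}=\{U_1\in\mathcal M^\beta_{n\times N}: U_1^\dagger U_1=I_N\}$ be the Stiefel manifold and $(U_1^\dagger \mathrm dU_1)$ its measure invariant under the unitary group $\{U\in\mathcal M^\beta_{n\times n}:U^\dagger U=I_n\}$, normalised to have total mass $$\prod_{i=1}^N\sigma_{\beta(n-i+1)},\qquad \sigma_l=\frac{2\pi^{l/2}}{\Gamma(l/2)}.$$ Let $\mathcal P^\beta_{+,N}$ be the set of $N\times N$ Hermitian matrices $W$ over $\mathbb F_\beta$ with all eigenvalues non-negative, let $(\mathrm dW)$ be the product of the real differentials of the diagonal entries and of all the real components of the entries strictly above the diagonal, let $W^{1/2}\in\mathcal P^\beta_{+,N}$ be the square root of $W$, and let $\det W$ be the product of the $N$ eigenvalues of $W$, repeated according to multiplicity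 over $\mathbb F_\beta$ (so for $\beta=4$ the doubling of the eigenvalues in the representation of $W$ as a complex $2N\times 2N$ matrix is ignored). Every $M\in\mathcal M^\beta_{n\times N}$ has a polar decomposition $M=U_1W^{1/2}$ with $U_1\in\mathcal V^\beta_{N,n}$ and $W=M^\dagger M\in\mathcal P^\beta_{+,N}$. Moreover, for every absolutely integrable $g:\mathcal M^\beta_{n\times N}\to\mathbb R$, $$\int_{\mathcal M^\beta_{n\times N}} g(M)\,(\mathrm dM)=2^{-N}\int_{\mathcal V^\beta_{N,n}}(U_1^\dagger \mathrm dU_1)\int_{\mathcal P^\beta_{+,N}}(\mathrm dW)\,(\det W)^{\beta(n-N+1)/2-1}\,g(U_1W^{1/2}),$$ where the integrand on the right is absolutely integrable with respect to the product measure $(U_1^\dagger \mathrm dU_1)\,(\mathrm dW)$ on $\mathcal V^\beta_{N,n}\times\mathcal P^\beta_{+,N}$. -/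

import Mathlib

open MeasureTheory Matrix
open scoped Quaternion

noncomputable section

namespace MatrixPolar

/-- The real quaternions carry the Borel sigma-algebra.  With it, `volume` on `ℍ[ℝ]` is the Lebesgue
measure of the Euclidean space `ℍ[ℝ]`, in which `1, i, j, k` is an orthonormal basis. -/
instance instMeasurableSpaceQuaternion : MeasurableSpace ℍ[ℝ] := borel _

instance instBorelSpaceQuaternion : BorelSpace ℍ[ℝ] := ⟨rfl⟩

instance instMeasurableSpaceMatrix {m k F : Type*} [MeasurableSpace F] :
    MeasurableSpace (Matrix m k F) :=
  inferInstanceAs (MeasurableSpace (m → k → F))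

instance instBorelSpaceMatrix {m k F : Type*} [Countable m] [Countable k] [TopologicalSpace F]
    [SecondCountableTopology F] [MeasurableSpace F] [BorelSpace F] :
    BorelSpace (Matrix m k F) :=
  inferInstanceAs (BorelSpace (m → k → F))

/-- The compatibility of conjugation and absolute value, `ā a = |a|²`, in `ℝ`, `ℂ` and `ℍ`. -/
class ConjNorm (F : Type*) [NormedDivisionRing F] [NormedAlgebra ℝ F] [StarRing F] : Prop where
  star_mul_self_eq : ∀ a : F, star a * a = algebraMap ℝ F (‖a‖ ^ 2)

instance instConjNormReal : ConjNorm ℝ := ⟨fun a => by simp [sq]⟩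

instance instConjNormComplex : ConjNorm ℂ := ⟨fun a => by
  have h := Complex.conj_mul' a
  simpa using h⟩

instance instConjNormQuaternion : ConjNorm ℍ[ℝ] := ⟨fun a => by
  rw [Quaternion.star_mul_self, Quaternion.normSq_eq_norm_mul_self, sq]
  rfl⟩

/-- The number `β`, i.e. the real dimension of `F`. -/
def beta (F : Type*) [NormedDivisionRing F] [NormedAlgebra ℝ F] : ℕ := Module.finrank ℝ F

theorem beta_real : beta ℝ = 1 := Module.finrank_self ℝ

theorem beta_complex : beta ℂ = 2 := Complex.finrank_real_complex

theorem beta_quaternion : beta ℍ[ℝ] = 4 := Quaternion.finrank_eq_four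

/-- `(dM)`: Lebesgue measure on `n × N` matrices, the product over all entries of Lebesgue measure
on `F`. -/
def matrixMeasure (F : Type*) [MeasureSpace F] (n N : ℕ) : Measure (Matrix (Fin n) (Fin N) F) :=
  Measure.pi fun _ : Fin n => Measure.pi fun _ : Fin N => (volume : Measure F)

/-- The independent entries of an `N × N` Hermitian matrix: the real diagonal entries and the
entries strictly above the diagonal. -/
abbrev HermitianEntries (F : Type*) (N : ℕ) : Type _ :=
  (Fin N → ℝ) × ({p : Fin N × Fin N // p.1 < p.2} → F)

/-- The Hermitian matrix with the given independent entries. -/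
def hermitianOfEntries {F : Type*} [NormedDivisionRing F] [NormedAlgebra ℝ F] [StarRing F] {N : ℕ}
    (c : HermitianEntries F N) : Matrix (Fin N) (Fin N) F :=
  fun i j =>
    if hij : i < j then c.2 ⟨(i, j), hij⟩
    else if hji : j < i then star (c.2 ⟨(j, i), hji⟩)
    else algebraMap ℝ F (c.1 i)

/-- `(dW)`: the product of the Lebesgue measures of the independent entries of a Hermitian matrix,
as a measure carried by the Hermitian matrices. -/
def hermitianMeasure (F : Type*) [NormedDivisionRing F] [NormedAlgebra ℝ F] [StarRing F]
    [MeasureSpace F] (N : ℕ) : Measure (Matrix (Fin N) (Fin N) F) :=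
  Measure.map hermitianOfEntries (volume : Measure (HermitianEntries F N))

/-- The Hermitian matrices all of whose eigenvalues are non-negative.  (Over the quaternions the
eigenvalues are the right eigenvalues `W v = v λ`; those of a Hermitian matrix are real, and in the
representation by complex `2N × 2N` matrices they are the eigenvalues, each with its multiplicity
doubled.) -/
def posHermitian (F : Type*) [NormedDivisionRing F] [NormedAlgebra ℝ F] [StarRing F] (N : ℕ) :
    Set (Matrix (Fin N) (Fin N) F) :=
  {W | W.IsHermitian ∧ ∀ (l : ℝ) (v : Fin N → F), v ≠ 0 → W *ᵥ v = l • v → 0 ≤ l}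

/-- The real-linear map `v ↦ W v` of `F ^ N`. -/
def mulVecReal {F : Type*} [NormedDivisionRing F] [NormedAlgebra ℝ F] {N : ℕ}
    (W : Matrix (Fin N) (Fin N) F) : Module.End ℝ (Fin N → F) where
  toFun v := W *ᵥ v
  map_add' := Matrix.mulVec_add W
  map_smul' c v := Matrix.mulVec_smul W c v

/-- The determinant of a Hermitian matrix: the product of its eigenvalues, repeated according to
their multiplicity over `F`, that is, the dimension over `F` of the eigenspace, which is its real
dimension divided by `β`. In the quaternion case the doubling of the multiplicities in the complex
`2N × 2N` representation is thus ignored. -/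
def hermitianDet {F : Type*} [NormedDivisionRing F] [NormedAlgebra ℝ F] {N : ℕ}
    (W : Matrix (Fin N) (Fin N) F) : ℝ :=
  ∏ᶠ l : ℝ, l ^ (Module.finrank ℝ ((mulVecReal W).eigenspace l) / beta F)

open Classical in
/-- `W ^ (1/2)`: the positive semidefinite square root of a positive semidefinite Hermitian `W`
(and `0` for every other `W`). -/
def hermitianSqrt {F : Type*} [NormedDivisionRing F] [NormedAlgebra ℝ F] [StarRing F] {N : ℕ}
    (W : Matrix (Fin N) (Fin N) F) : Matrix (Fin N) (Fin N) F :=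
  if h : ∃ P ∈ posHermitian F N, P * P = W then h.choose else 0

/-- The Stiefel manifold: `n × N` matrices with orthonormal columns. -/
def stiefel (F : Type*) [NormedDivisionRing F] [StarRing F] (n N : ℕ) :
    Set (Matrix (Fin n) (Fin N) F) :=
  {U | Uᴴ * U = 1}

/-- The group of unitary `n × n` matrices over `F`: `O(n)`, `U(n)`, `Sp(n)`. -/
abbrev unitaryGrp (F : Type*) [NormedDivisionRing F] [StarRing F] (n : ℕ) :
    Submonoid (Matrix (Fin n) (Fin n) F) :=
  unitary (Matrix (Fin n) (Fin n) F)

instance instCompactSpaceUnitary {F : Type*} [NormedDivisionRing F] [NormedAlgebra ℝ F]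
    [StarRing F] [ContinuousStar F] [ProperSpace F] [ConjNorm F] (n : ℕ) :
    CompactSpace (unitaryGrp F n) := by
  refine isCompact_iff_compactSpace.1
    (?_ : IsCompact (unitaryGrp F n : Set (Matrix (Fin n) (Fin n) F)))
  have hK : IsCompact
      {U : Matrix (Fin n) (Fin n) F | ∀ i j, U i j ∈ Metric.closedBall (0 : F) 1} := by
    have h : IsCompact (Set.univ.pi fun _ => Set.univ.pi fun _ => Metric.closedBall (0 : F) 1 :
        Set (Fin n → Fin n → F)) :=
      isCompact_univ_pi fun _ => isCompact_univ_pi fun _ => isCompact_closedBall _ _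
    have e : {U : Matrix (Fin n) (Fin n) F | ∀ i j, U i j ∈ Metric.closedBall (0 : F) 1} =
        (Set.univ.pi fun _ => Set.univ.pi fun _ => Metric.closedBall (0 : F) 1 :
          Set (Fin n → Fin n → F)) :=
      Set.ext fun U => ⟨fun hU i _ j _ => hU i j, fun hU i j => hU i trivial j trivial⟩
    rw [e]
    exact h
  refine hK.of_isClosed_subset isClosed_unitary ?_
  intro U hU i j
  have h1 : Uᴴ * U = 1 := (Unitary.mem_iff.1 hU).1
  have h2 : (∑ k, algebraMap ℝ F (‖U k j‖ ^ 2)) = 1 := by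
    have := congrFun (congrFun h1 j) j
    simpa [Matrix.mul_apply, ConjNorm.star_mul_self_eq] using this
  have h3 : (∑ k, ‖U k j‖ ^ 2) = 1 := by
    apply (algebraMap ℝ F).injective
    rw [map_sum, h2, map_one]
  have h4 : ‖U i j‖ ^ 2 ≤ 1 := by
    rw [← h3]
    exact Finset.single_le_sum (f := fun k => ‖U k j‖ ^ 2) (fun k _ => sq_nonneg _)
      (Finset.mem_univ i)
  have h5 : ‖U i j‖ ≤ 1 := by
    nlinarith [norm_nonneg (U i j)]
  simpa using h5

/-- The first `N` columns of a unitary `n × n` matrix. -/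
def firstColumns {F : Type*} [NormedDivisionRing F] [StarRing F] {n N : ℕ} (h : N ≤ n)
    (U : unitaryGrp F n) : stiefel F n N :=
  ⟨(U : Matrix (Fin n) (Fin n) F).submatrix id (Fin.castLE h), by
    have h1 : (U : Matrix (Fin n) (Fin n) F)ᴴ * (U : Matrix (Fin n) (Fin n) F) = 1 :=
      (Unitary.mem_iff.1 U.2).1
    have h2 := congrArg (fun A => A.submatrix (Fin.castLE h) (Fin.castLE h)) h1
    simp only [Matrix.submatrix_one _ (Fin.castLE_injective h)] at h2
    exact h2⟩

/-- `σ_l = 2 π ^ (l/2) / Γ(l/2)`, the surface area of the unit sphere in `ℝ ^ l`. -/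
def sphereArea (l : ℝ) : ℝ := 2 * Real.pi ^ (l / 2) / Real.Gamma (l / 2)

/-- The total mass of the invariant measure on the Stiefel manifold, the product over
`i = 1, …, N` of `σ_{β (n - i + 1)}`. -/
def stiefelMass (F : Type*) [NormedDivisionRing F] [NormedAlgebra ℝ F] (n N : ℕ) : ℝ :=
  ∏ i ∈ Finset.Icc 1 N, sphereArea ((beta F : ℝ) * ((n : ℝ) - (i : ℝ) + 1))

/-- `(U₁† dU₁)`: the invariant measure on the Stiefel manifold, that is, the image of the Haar
probability measure of the unitary group under taking the first `N` columns, multiplied by the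
total mass. -/
def stiefelMeasure (F : Type*) [NormedDivisionRing F] [NormedAlgebra ℝ F] [StarRing F]
    [ContinuousStar F] [ProperSpace F] [ConjNorm F] [MeasurableSpace F] [BorelSpace F]
    {n N : ℕ} (h : N ≤ n) : Measure (stiefel F n N) :=
  ENNReal.ofReal (stiefelMass F n N) •
    Measure.map (firstColumns h)
      (Measure.haarMeasure (⊤ : TopologicalSpace.PositiveCompacts (unitaryGrp F n)))

/-- The matrix polar integration theorem for `n × N` matrices over `F`, `N ≤ n`. The first part is
the polar decomposition `M = U₁ W ^ (1/2)`, `W = M† M`. The second part is the integration formula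
for `g` absolutely integrable; it contains that the right-hand side is absolutely convergent. -/
def PolarIntegration (F : Type*) [NormedDivisionRing F] [NormedAlgebra ℝ F] [StarRing F]
    [ContinuousStar F] [ProperSpace F] [ConjNorm F] [MeasureSpace F] [BorelSpace F]
    {n N : ℕ} (h : N ≤ n) : Prop :=
  (∀ M : Matrix (Fin n) (Fin N) F, Mᴴ * M ∈ posHermitian F N ∧
    ∃ U : stiefel F n N, M = (U : Matrix (Fin n) (Fin N) F) * hermitianSqrt (Mᴴ * M)) ∧
  ∀ g : Matrix (Fin n) (Fin N) F → ℝ, Integrable g (matrixMeasure F n N) →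
    Integrable
      (fun p : stiefel F n N × Matrix (Fin N) (Fin N) F =>
        hermitianDet p.2 ^ ((beta F : ℝ) * ((n : ℝ) - (N : ℝ) + 1) / 2 - 1) *
          g ((p.1 : Matrix (Fin n) (Fin N) F) * hermitianSqrt p.2))
      ((stiefelMeasure F h).prod ((hermitianMeasure F N).restrict (posHermitian F N))) ∧
    ∫ M, g M ∂(matrixMeasure F n N) =
      ((2 : ℝ) ^ N)⁻¹ *
        ∫ U : stiefel F n N,
          (∫ W in posHermitian F N,
            hermitianDet W ^ ((beta F : ℝ) * ((n : ℝ) - (N : ℝ) + 1) / 2 - 1) *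
              g ((U : Matrix (Fin n) (Fin N) F) * hermitianSqrt W)
            ∂(hermitianMeasure F N))
          ∂(stiefelMeasure F h)

end MatrixPolar

end

/-!
The argument is carried out once for a normed division ring `F` over `ℝ` with `ā a = |a|²`, whose
Haar measure is normalised by a Gaussian integral; the three cases are instances. Commutativity of
`F` is never used. Scalar invariants of a Hermitian matrix `W` are real: the form
`v† W v`, and the determinant `detR W` of the real-linear map `v ↦ W v`, which is multiplicative
and is the `β`-th power of the determinant of `W`.

*Polar decomposition.* The spectral theorem `exists_eq_unitaryConj` gives the square root, unique by
`posHermitian_mul_self_injective`. If `M† M = U diag(d) U†`, then the columns of `M U` are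
orthogonal with squared norms `d`. Normalising the nonzero ones and completing them to an
orthonormal family gives the isometric factor, also when `M` is not of full rank (`exists_polar`).

*The law of the Gram matrix.* The image of `(dM)` under `M ↦ M† M` has density
`∏ (σ / 2) (det W) ^ (β (n - N + 1) / 2 - 1)` with respect to `(dW)` (`lintegral_gram`). This is
shown by induction on the number of columns. With `n = N + m`, let `M = U S` be `n × N` of full
rank with `S² = M† M = W`, and let `v` be a further column. A unitary change of variables takes
`U` to the first `N` coordinate vectors and `v` to `(y, w)` with `y ∈ F ^ N`, `w ∈ F ^ m`. The new
Gram matrix is `[W u; u† t]`, where `u = S y` and `t = |y|² + s` with `s = |w|²`. The passage from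
`y` to `u` has Jacobian `detR S`; the passage from `w` to `s` gives the weight
`(σ / 2) s ^ (β m / 2 - 1)` (`lintegral_normSqVec`); and `s` is the Schur complement of `W`, so that
`det [W u; u† t] = s det W` (`detR_hermBlock`). The powers of `det W` combine to the density for
`N + 1` columns (`lintegral_appendCol`).

*Averaging.* Lebesgue measure on matrices is invariant under `M ↦ k M` for unitary `k`, and the
unitary group acts transitively on the matrices with a given Gram matrix. Hence `∫ G (M) dM` is
unchanged when `G (M)` is replaced by the Haar average of `G (k₁ W ^ (1/2))`, where `W = M† M` and
`k₁` consists of the first `N` columns of `k` (`lintegral_matrixMeasure_eq_average`). This is a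
function of `W` alone, to which the law of the Gram matrix applies. The result is an identity of
measures, `matrixMeasure_eq_map`, from which the statement on integrable functions follows. Singular
`W` may be ignored, as they form a null set (`hermitianMeasure_singular`).
-/

noncomputable section

namespace MatrixPolar

/-! ### Scalars and vectors -/

section NormSqVec

variable {F : Type*} [NormedDivisionRing F]

/-- The squared Euclidean norm of a vector over `F`. -/
def normSqVec {ι : Type*} [Fintype ι] (v : ι → F) : ℝ := ∑ i, ‖v i‖ ^ 2

theorem normSqVec_nonneg {ι : Type*} [Fintype ι] (v : ι → F) : 0 ≤ normSqVec v :=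
  Finset.sum_nonneg fun _ _ => sq_nonneg _

theorem normSqVec_eq_zero {ι : Type*} [Fintype ι] {v : ι → F} : normSqVec v = 0 ↔ v = 0 := by
  rw [normSqVec, Finset.sum_eq_zero_iff_of_nonneg fun _ _ => sq_nonneg _]
  simp [funext_iff]

theorem normSqVec_pos {ι : Type*} [Fintype ι] {v : ι → F} (hv : v ≠ 0) : 0 < normSqVec v :=
  (normSqVec_nonneg v).lt_of_ne fun h => hv (normSqVec_eq_zero.1 h.symm)

theorem continuous_normSqVec {ι : Type*} [Fintype ι] :
    Continuous (normSqVec : (ι → F) → ℝ) := by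
  unfold normSqVec
  fun_prop

theorem norm_toLp_eq_sqrt {m : ℕ} (x : PiLp 2 fun _ : Fin m => F) :
    ‖x‖ = √(normSqVec (WithLp.ofLp x)) := by
  rw [normSqVec, ← PiLp.norm_sq_eq_of_L2, Real.sqrt_sq (norm_nonneg _)]

theorem isBounded_normSqVec_lt {ι : Type*} [Fintype ι] :
    Bornology.IsBounded {v : ι → F | normSqVec v < 1} := by
  refine (Metric.isBounded_closedBall (x := (0 : ι → F)) (r := 1)).subset fun v hv => ?_
  rw [mem_closedBall_zero_iff, pi_norm_le_iff_of_nonneg zero_le_one]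
  intro i
  have h : ‖v i‖ ^ 2 ≤ normSqVec v :=
    Finset.single_le_sum (f := fun i => ‖v i‖ ^ 2) (fun _ _ => sq_nonneg _) (Finset.mem_univ i)
  have h' : normSqVec v < 1 := hv
  nlinarith [norm_nonneg (v i)]

theorem normSqVec_append {N m : ℕ} (y : Fin N → F) (w : Fin m → F) :
    normSqVec (Fin.append y w) = normSqVec y + normSqVec w := by
  simp [normSqVec, Fin.sum_univ_add]

/-- The real part `(a + ā) / 2` of a scalar, written through the norm by polarisation. -/
def realPart (a : F) : ℝ := (‖1 + a‖ ^ 2 - 1 - ‖a‖ ^ 2) / 2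

theorem continuous_realPart : Continuous (realPart : F → ℝ) := by
  unfold realPart
  fun_prop

end NormSqVec

section Scalars

variable {F : Type*} [NormedDivisionRing F] [NormedAlgebra ℝ F] [StarRing F] [ConjNorm F]

theorem star_algebraMap (r : ℝ) : star (algebraMap ℝ F r) = algebraMap ℝ F r := by
  rcases eq_or_ne r 0 with rfl | hr
  · simp
  · have h := ConjNorm.star_mul_self_eq (algebraMap ℝ F r)
    rw [norm_algebraMap', Real.norm_eq_abs, sq_abs, sq, map_mul] at h
    exact mul_right_cancel₀ (by simpa using hr) h

instance instStarModule : StarModule ℝ F := ⟨fun r a => by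
  rw [Algebra.smul_def, star_mul, star_algebraMap, ← Algebra.commutes, ← Algebra.smul_def]
  simp⟩

theorem algebraMap_realPart (a : F) :
    algebraMap ℝ F (realPart a) = (2⁻¹ : ℝ) • (a + star a) := by
  have h := ConjNorm.star_mul_self_eq (1 + a)
  rw [star_add, star_one, add_mul, mul_add, mul_add, one_mul, one_mul, mul_one,
    ConjNorm.star_mul_self_eq a] at h
  have e : (2 : ℝ) * realPart a = ‖1 + a‖ ^ 2 - 1 - ‖a‖ ^ 2 := by
    unfold realPart; ring
  have e' := congrArg (algebraMap ℝ F) e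
  rw [map_sub, map_sub, ← h, map_one] at e'
  have : a + star a = (2 : ℝ) • algebraMap ℝ F (realPart a) := by
    rw [Algebra.smul_def, ← map_mul, map_mul, ← map_mul, e']
    abel
  rw [this, smul_smul]
  norm_num

theorem realPart_algebraMap (r : ℝ) : realPart (algebraMap ℝ F r) = r := by
  apply (algebraMap ℝ F).injective
  rw [algebraMap_realPart, star_algebraMap, ← two_smul ℝ, smul_smul]
  norm_num

theorem realPart_add (a b : F) : realPart (a + b) = realPart a + realPart b := by
  apply (algebraMap ℝ F).injective
  rw [map_add, algebraMap_realPart, algebraMap_realPart, algebraMap_realPart, ← smul_add, star_add]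
  congr 1
  abel

theorem realPart_smul (r : ℝ) (a : F) : realPart (r • a) = r * realPart a := by
  apply (algebraMap ℝ F).injective
  rw [map_mul, algebraMap_realPart, algebraMap_realPart, star_smul, star_trivial, ← smul_add,
    ← Algebra.smul_def, smul_comm]

theorem realPart_star (a : F) : realPart (star a) = realPart a := by
  apply (algebraMap ℝ F).injective
  rw [algebraMap_realPart, algebraMap_realPart, star_star, add_comm]

theorem star_dotProduct_self {ι : Type*} [Fintype ι] (v : ι → F) :
    star v ⬝ᵥ v = algebraMap ℝ F (normSqVec v) := by
  simp [dotProduct, normSqVec, ConjNorm.star_mul_self_eq]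

end Scalars

/-! ### Orthonormal families and the spectral theorem -/

section Orthonormal

variable {F : Type*} [NormedDivisionRing F] [StarRing F]

theorem star_dotProduct_star {ι : Type*} [Fintype ι] (v w : ι → F) :
    star (star v ⬝ᵥ w) = star w ⬝ᵥ v := by
  simp [dotProduct]

/-- The members of the family `e` with index in `T` are orthonormal. -/
def OrthonormalOn {n m : ℕ} (e : Fin m → Fin n → F) (T : Finset (Fin m)) : Prop :=
  ∀ i ∈ T, ∀ j ∈ T, star (e i) ⬝ᵥ e j = if i = j then 1 else 0

/-- The family `e` is the family of columns of `(of e)ᵀ`. -/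
theorem OrthonormalOn.conjTranspose_mul_self {n m : ℕ} {e : Fin m → Fin n → F}
    (he : OrthonormalOn e Finset.univ) : ((of e)ᵀ)ᴴ * (of e)ᵀ = 1 := by
  ext i j
  rw [one_apply, ← he i (Finset.mem_univ _) j (Finset.mem_univ _)]
  rfl

theorem orthonormalOn_columns {n m : ℕ} {U : Matrix (Fin n) (Fin m) F} (hU : Uᴴ * U = 1) :
    OrthonormalOn (fun j i => U i j) Finset.univ := fun i _ j _ => by
  rw [← one_apply, ← hU]
  rfl

theorem conjTranspose_firstColumns_mul {N m : ℕ} (k : unitaryGrp F (N + m)) :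
    (firstColumns (Nat.le_add_right N m) k : Matrix (Fin (N + m)) (Fin N) F)ᴴ *
      (k : Matrix (Fin (N + m)) (Fin (N + m)) F) = fun i => Fin.append (Pi.single i 1) 0 := by
  have hk1 : (k : Matrix (Fin (N + m)) (Fin (N + m)) F)ᴴ * k = 1 := (Unitary.mem_iff.1 k.2).1
  ext i j
  refine Eq.trans (congrFun (congrFun hk1 (Fin.castAdd m i)) j) ?_
  induction j using Fin.addCases with
  | left j => simp [one_apply, Pi.single_apply, eq_comm]
  | right j =>
    rw [Fin.append_right, one_apply_ne]
    · rfl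
    · exact fun h => by
        have := congrArg Fin.val h
        simp at this
        omega

/-- A one-sided inverse of a square matrix is two-sided also over the noncommutative `F`. -/
theorem mul_conjTranspose_of_conjTranspose_mul {N : ℕ} {U : Matrix (Fin N) (Fin N) F}
    (hU : Uᴴ * U = 1) : U * Uᴴ = 1 := mul_eq_one_comm.1 hU

theorem mem_unitaryGrp_of_conjTranspose_mul {N : ℕ} {U : Matrix (Fin N) (Fin N) F}
    (hU : Uᴴ * U = 1) : U ∈ unitaryGrp F N :=
  Unitary.mem_iff.2 ⟨hU, mul_conjTranspose_of_conjTranspose_mul hU⟩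

variable [NormedAlgebra ℝ F]

/-- The vectors orthogonal to `e i` for all `i ∈ T`, as a real subspace. -/
def orthoCompl {n m : ℕ} (e : Fin m → Fin n → F) (T : Finset (Fin m)) :
    Submodule ℝ (Fin n → F) where
  carrier := {v | ∀ i ∈ T, star (e i) ⬝ᵥ v = 0}
  add_mem' hv hw i hi := by rw [dotProduct_add, hv i hi, hw i hi, add_zero]
  zero_mem' i _ := dotProduct_zero _
  smul_mem' c v hv i hi := by rw [dotProduct_smul, hv i hi, smul_zero]

/-- Fewer than `m ≤ n` linear conditions over `F` do not determine a vector of `F ^ n`: otherwise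
the map that records the conditions, padded by zeros to `F ^ m`, would be onto. -/
theorem orthoCompl_ne_bot [FiniteDimensional ℝ F] {n m : ℕ} (hmn : m ≤ n) (e : Fin m → Fin n → F)
    (T : Finset (Fin m)) {j : Fin m} (hj : j ∉ T) : orthoCompl e T ≠ ⊥ := by
  classical
  let f : (Fin n → F) →ₗ[ℝ] (Fin m → F) :=
    { toFun := fun v i => if i ∈ T then star (e i) ⬝ᵥ v else 0
      map_add' := fun v w => by
        ext i; by_cases h : i ∈ T <;> simp [h, dotProduct_add]
      map_smul' := fun c v => by
        ext i; by_cases h : i ∈ T <;> simp [h, dotProduct_smul] }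
  have hk : LinearMap.ker f = orthoCompl e T := by
    ext v
    rw [LinearMap.mem_ker]
    constructor
    · intro h i hi
      have := congrFun h i
      simpa [f, hi] using this
    · intro h
      ext i
      by_cases hi : i ∈ T
      · simpa [f, hi] using h i hi
      · simp [f, hi]
  rw [← hk]
  intro hbot
  have hinj : Function.Injective f := LinearMap.ker_eq_bot.1 hbot
  have hfin : Module.finrank ℝ (Fin n → F) = Module.finrank ℝ (Fin m → F) := by
    apply le_antisymm (LinearMap.finrank_le_finrank_of_injective hinj)
    simp only [Module.finrank_pi_fintype, Finset.sum_const, Finset.card_univ, Fintype.card_fin,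
      smul_eq_mul]
    gcongr
  have hsurj := (LinearMap.injective_iff_surjective_of_finrank_eq_finrank hfin).1 hinj
  obtain ⟨v, hv⟩ := hsurj (fun _ => 1)
  have := congrFun hv j
  simp [f, hj] at this

theorem OrthonormalOn.update {n m : ℕ} {e : Fin m → Fin n → F} {T : Finset (Fin m)}
    (he : OrthonormalOn e T) {j : Fin m} (hj : j ∉ T) {v : Fin n → F} (hv : v ∈ orthoCompl e T)
    (hv1 : star v ⬝ᵥ v = 1) : OrthonormalOn (Function.update e j v) (insert j T) := by
  have key : ∀ i ∈ T, Function.update e j v i = e i := fun i hi =>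
    Function.update_of_ne (by rintro rfl; exact hj hi) _ _
  have hne : ∀ i ∈ T, i ≠ j := fun i hi h => hj (h ▸ hi)
  intro i hi k hk
  rw [Finset.mem_insert] at hi hk
  rcases hi with rfl | hi <;> rcases hk with rfl | hk
  · simp [hv1]
  · rw [key k hk, Function.update_self, if_neg (hne k hk).symm, ← star_dotProduct_star, hv k hk,
      star_zero]
  · rw [key i hi, Function.update_self, if_neg (hne i hi), hv i hi]
  · rw [key i hi, key k hk, he i hi k hk]

variable [ConjNorm F]

theorem exists_unit_smul {n : ℕ} {v : Fin n → F} (hv : v ≠ 0) :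
    ∃ c : ℝ, star (c • v) ⬝ᵥ (c • v) = 1 := by
  have h := normSqVec_pos hv
  refine ⟨(√(normSqVec v))⁻¹, ?_⟩
  rw [star_smul, smul_dotProduct, dotProduct_smul, star_dotProduct_self, smul_smul,
    Algebra.smul_def, ← map_mul, star_trivial, ← mul_inv, Real.mul_self_sqrt h.le,
    inv_mul_cancel₀ h.ne', map_one]

/-- An orthonormal family indexed by `S ⊆ {0, …, m - 1}` in `F ^ n`, `m ≤ n`, extends to an
orthonormal family indexed by all of `{0, …, m - 1}`. -/
theorem OrthonormalOn.exists_extension [FiniteDimensional ℝ F] {n m : ℕ} (hmn : m ≤ n)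
    {e : Fin m → Fin n → F} {S : Finset (Fin m)} (he : OrthonormalOn e S) :
    ∃ e' : Fin m → Fin n → F, OrthonormalOn e' Finset.univ ∧ ∀ i ∈ S, e' i = e i := by
  classical
  have key : ∀ T : Finset (Fin m), ∃ e' : Fin m → Fin n → F,
      OrthonormalOn e' (S ∪ T) ∧ ∀ i ∈ S, e' i = e i := by
    intro T
    induction T using Finset.induction_on with
    | empty => exact ⟨e, by simpa using he, fun _ _ => rfl⟩
    | insert j T _ ih =>
      obtain ⟨e', h1, h2⟩ := ih
      rw [Finset.union_insert]
      by_cases hj : j ∈ S ∪ T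
      · exact ⟨e', by rwa [Finset.insert_eq_of_mem hj], h2⟩
      obtain ⟨v, hv, hv0⟩ := Submodule.exists_mem_ne_zero_of_ne_bot (orthoCompl_ne_bot hmn e' _ hj)
      obtain ⟨c, hc⟩ := exists_unit_smul hv0
      refine ⟨Function.update e' j (c • v), h1.update hj (Submodule.smul_mem _ _ hv) hc,
        fun i hi => ?_⟩
      rw [Function.update_of_ne, h2 i hi]
      rintro rfl
      exact hj (Finset.mem_union_left _ hi)
  obtain ⟨e', h1, h2⟩ := key Finset.univ
  exact ⟨e', by rwa [Finset.union_eq_right.2 (Finset.subset_univ S)] at h1, h2⟩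

/-- An operator that is symmetric for a real inner product, given as a bare form, has an
eigenvector. -/
theorem exists_eigenvector_of_form {E : Type*} [AddCommGroup E] [Module ℝ E]
    [FiniteDimensional ℝ E] [Nontrivial E] (B : E → E → ℝ) (hsymm : ∀ v w, B w v = B v w)
    (hpos : ∀ v, v ≠ 0 → 0 < B v v) (hadd : ∀ u v w, B (u + v) w = B u w + B v w)
    (hsmul : ∀ (r : ℝ) v w, B (r • v) w = r * B v w) (T : E →ₗ[ℝ] E)
    (hT : ∀ v w, B (T v) w = B v (T w)) : ∃ l : ℝ, ∃ v : E, v ≠ 0 ∧ T v = l • v := by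
  have h0 : B 0 0 = 0 := by simpa using hsmul 0 0 0
  let core : InnerProductSpace.Core ℝ E :=
    { inner := B
      conj_inner_symm := fun v w => hsymm v w
      re_inner_nonneg := fun v => by
        rcases eq_or_ne v 0 with rfl | hv
        · exact h0.ge
        · exact (hpos v hv).le
      add_left := hadd
      smul_left := fun v w r => hsmul r v w
      definite := fun v hv => by
        by_contra h
        exact (hpos v h).ne' hv }
  let _ : NormedAddCommGroup E := core.toNormedAddCommGroup
  let _ : InnerProductSpace ℝ E := InnerProductSpace.ofCore core.toCore
  have hT' : T.IsSymmetric := hT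
  obtain ⟨v, hv⟩ := hT'.hasEigenvalue_iSup_of_finiteDimensional.exists_hasEigenvector
  exact ⟨_, v, hv.2, hv.apply_eq_smul⟩

/-- A Hermitian matrix has an eigenvector with real eigenvalue in every nonzero real subspace that
it leaves invariant. The real part of the Hermitian form is a real inner product, for which the
matrix acts as a symmetric operator. -/
theorem exists_eigenvector [FiniteDimensional ℝ F] {N : ℕ} {W : Matrix (Fin N) (Fin N) F}
    (hW : W.IsHermitian) {K : Submodule ℝ (Fin N → F)} (hK : K ≠ ⊥)
    (hinv : ∀ v ∈ K, W *ᵥ v ∈ K) : ∃ l : ℝ, ∃ v ∈ K, v ≠ 0 ∧ W *ᵥ v = l • v := by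
  have : Nontrivial K := Submodule.nontrivial_iff_ne_bot.2 hK
  obtain ⟨l, v, hv, hl⟩ := exists_eigenvector_of_form
    (fun v w : K => realPart (star (v : Fin N → F) ⬝ᵥ (w : Fin N → F)))
    (fun v w => by rw [← realPart_star, star_dotProduct_star])
    (fun v hv => by
      rw [star_dotProduct_self, realPart_algebraMap]
      exact normSqVec_pos fun h => hv (Subtype.ext h))
    (fun u v w => by rw [← realPart_add, ← add_dotProduct, ← star_add]; rfl)
    (fun r v w => by
      rw [Submodule.coe_smul, star_smul, star_trivial, smul_dotProduct, realPart_smul])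
    ((mulVecReal W).restrict hinv)
    (fun v w => by
      change realPart (star (W *ᵥ (v : Fin N → F)) ⬝ᵥ (w : Fin N → F)) =
        realPart (star (v : Fin N → F) ⬝ᵥ (W *ᵥ (w : Fin N → F)))
      rw [star_mulVec, hW.eq, dotProduct_mulVec])
  exact ⟨l, v, v.2, fun h => hv (Subtype.ext h), congrArg Subtype.val hl⟩

/-- The orthogonal complement of eigenvectors is invariant, so a further one can be found in it. -/
theorem exists_orthonormal_eigenvectors [FiniteDimensional ℝ F] {N : ℕ}
    {W : Matrix (Fin N) (Fin N) F} (hW : W.IsHermitian) :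
    ∃ (e : Fin N → Fin N → F) (d : Fin N → ℝ), OrthonormalOn e Finset.univ ∧
      ∀ i, W *ᵥ e i = d i • e i := by
  classical
  have key : ∀ T : Finset (Fin N), ∃ (e : Fin N → Fin N → F) (d : Fin N → ℝ), OrthonormalOn e T ∧
      ∀ i ∈ T, W *ᵥ e i = d i • e i := by
    intro T
    induction T using Finset.induction_on with
    | empty => exact ⟨0, 0, by simp [OrthonormalOn], by simp⟩
    | insert j T hj ih =>
      obtain ⟨e, d, h1, h2⟩ := ih
      have hinv : ∀ v ∈ orthoCompl e T, W *ᵥ v ∈ orthoCompl e T := fun v hv i hi => by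
        have : star (e i) ᵥ* W = d i • star (e i) := by
          conv_lhs => rw [← hW.eq]
          rw [← star_mulVec, h2 i hi, star_smul, star_trivial]
        rw [dotProduct_mulVec, this, smul_dotProduct, hv i hi, smul_zero]
      obtain ⟨l, v, hv, hv0, hl⟩ := exists_eigenvector hW (orthoCompl_ne_bot le_rfl e T hj) hinv
      obtain ⟨c, hc⟩ := exists_unit_smul hv0
      refine ⟨Function.update e j (c • v), Function.update d j l,
        h1.update hj (Submodule.smul_mem _ _ hv) hc, fun i hi => ?_⟩
      by_cases hij : i = j
      · subst hij
        simp only [Function.update_self]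
        rw [mulVec_smul, hl, smul_comm]
      · rw [Function.update_of_ne hij, Function.update_of_ne hij,
          h2 i (Finset.mem_of_mem_insert_of_ne hi hij)]
  obtain ⟨e, d, h1, h2⟩ := key Finset.univ
  exact ⟨e, d, h1, fun i => h2 i (Finset.mem_univ i)⟩

/-- The Hermitian matrix `U diag(d) U†`. -/
def unitaryConj {N : ℕ} (U : Matrix (Fin N) (Fin N) F) (d : Fin N → ℝ) :
    Matrix (Fin N) (Fin N) F :=
  U * diagonal (fun i => algebraMap ℝ F (d i)) * Uᴴ

/-- The spectral theorem over `ℝ`, `ℂ` and `ℍ`. -/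
theorem exists_eq_unitaryConj [FiniteDimensional ℝ F] {N : ℕ} {W : Matrix (Fin N) (Fin N) F}
    (hW : W.IsHermitian) :
    ∃ (U : Matrix (Fin N) (Fin N) F) (d : Fin N → ℝ), Uᴴ * U = 1 ∧ W = unitaryConj U d := by
  obtain ⟨e, d, h1, h2⟩ := exists_orthonormal_eigenvectors hW
  refine ⟨(of e)ᵀ, d, h1.conjTranspose_mul_self, ?_⟩
  have h3 : W * (of e)ᵀ = (of e)ᵀ * diagonal (fun i => algebraMap ℝ F (d i)) := by
    ext i j
    rw [mul_diagonal]
    have := congrFun (h2 j) i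
    rw [Pi.smul_apply, Algebra.smul_def, Algebra.commutes] at this
    exact this
  rw [unitaryConj, ← h3, mul_assoc,
    mul_conjTranspose_of_conjTranspose_mul h1.conjTranspose_mul_self, mul_one]

/-- The first `N` columns of some unitary matrix are a given matrix with orthonormal columns. -/
theorem exists_firstColumns_eq [FiniteDimensional ℝ F] {n N : ℕ} (h : N ≤ n) (U : stiefel F n N) :
    ∃ k : unitaryGrp F n, firstColumns h k = U := by
  classical
  have hU := orthonormalOn_columns U.2
  let e : Fin n → Fin n → F := fun j => if hj : (j : ℕ) < N then fun i => U.1 i ⟨j, hj⟩ else 0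
  have he : OrthonormalOn e (Finset.univ.filter fun j : Fin n => (j : ℕ) < N) := by
    intro i hi j hj
    have hi : (i : ℕ) < N := (Finset.mem_filter.1 hi).2
    have hj : (j : ℕ) < N := (Finset.mem_filter.1 hj).2
    simp only [e, hi, hj, dif_pos]
    rw [hU ⟨i, hi⟩ (Finset.mem_univ _) ⟨j, hj⟩ (Finset.mem_univ _)]
    simp [Fin.ext_iff]
  obtain ⟨e', h1, h2⟩ := he.exists_extension le_rfl
  refine ⟨⟨(of e')ᵀ, mem_unitaryGrp_of_conjTranspose_mul h1.conjTranspose_mul_self⟩, ?_⟩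
  ext i j
  have := h2 (Fin.castLE h j) (by simp)
  change e' (Fin.castLE h j) i = U.1 i j
  rw [this]
  simp [e]

end Orthonormal

/-! ### Positive semidefinite matrices and their determinant -/

section Positive

variable {F : Type*} [NormedDivisionRing F] [NormedAlgebra ℝ F]

theorem inv_two_add_inv_two : (2⁻¹ : F) + 2⁻¹ = 1 := by
  have h : algebraMap ℝ F (2⁻¹ + 2⁻¹) = 1 := by norm_num
  simpa [map_ofNat] using h

theorem beta_pos [FiniteDimensional ℝ F] : 0 < beta F := Module.finrank_pos

/-- The determinant of the real-linear map `v ↦ W v`. -/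
def detR {N : ℕ} (W : Matrix (Fin N) (Fin N) F) : ℝ := LinearMap.det (mulVecReal W)

theorem detR_mul {N : ℕ} (A B : Matrix (Fin N) (Fin N) F) : detR (A * B) = detR A * detR B := by
  have : mulVecReal (A * B) = mulVecReal A * mulVecReal B := by
    refine LinearMap.ext fun v => ?_
    exact (mulVec_mulVec v A B).symm
  rw [detR, this, map_mul, detR, detR]

theorem detR_one {N : ℕ} : detR (1 : Matrix (Fin N) (Fin N) F) = 1 := by
  have : mulVecReal (1 : Matrix (Fin N) (Fin N) F) = 1 := by
    refine LinearMap.ext fun v => ?_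
    exact one_mulVec v
  rw [detR, this, map_one]

theorem detR_diagonal [FiniteDimensional ℝ F] {N : ℕ} (d : Fin N → ℝ) :
    detR (diagonal fun i => algebraMap ℝ F (d i)) = (∏ i, d i) ^ beta F := by
  have : mulVecReal (diagonal fun i => algebraMap ℝ F (d i)) =
      LinearMap.pi fun i => (d i • (1 : Module.End ℝ F)) ∘ₗ LinearMap.proj i := by
    refine LinearMap.ext fun v => ?_
    funext i
    simp [mulVecReal, mulVec_diagonal, Algebra.smul_def]
  rw [detR, this, LinearMap.det_pi]
  simp [beta, Finset.prod_pow]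

theorem continuous_detR [ProperSpace F] {N : ℕ} :
    Continuous (detR : Matrix (Fin N) (Fin N) F → ℝ) := by
  have := FiniteDimensional.of_locallyCompactSpace (E := F) ℝ
  let b := Module.finBasis ℝ (Fin N → F)
  have h : (detR : Matrix (Fin N) (Fin N) F → ℝ) =
      fun W => (LinearMap.toMatrix b b (mulVecReal W)).det := by
    funext W
    rw [LinearMap.det_toMatrix, detR]
  rw [h]
  refine Continuous.matrix_det (continuous_matrix fun i j => ?_)
  simp only [LinearMap.toMatrix_apply]
  have h1 : Continuous fun x : Fin N → F => b.repr x i :=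
    LinearMap.continuous_of_finiteDimensional (b.coord i)
  exact h1.comp (continuous_id.matrix_mulVec continuous_const)

variable [StarRing F]

/-- The Hermitian form `v† W v` of a Hermitian matrix `W`, as a real number. -/
def hermForm {N : ℕ} (W : Matrix (Fin N) (Fin N) F) (v : Fin N → F) : ℝ :=
  realPart (star v ⬝ᵥ W *ᵥ v)

omit [NormedAlgebra ℝ F] in
theorem hermForm_conjTranspose_mul_mul {n N : ℕ} (A : Matrix (Fin n) (Fin N) F)
    (W : Matrix (Fin n) (Fin n) F) (v : Fin N → F) :
    hermForm (Aᴴ * W * A) v = hermForm W (A *ᵥ v) := by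
  rw [hermForm, hermForm, star_mulVec, ← dotProduct_mulVec, mulVec_mulVec, mulVec_mulVec,
    Matrix.mul_assoc]

variable [ConjNorm F]

theorem hermForm_diagonal {N : ℕ} (d : Fin N → ℝ) (v : Fin N → F) :
    hermForm (diagonal fun i => algebraMap ℝ F (d i)) v = ∑ i, d i * ‖v i‖ ^ 2 := by
  have : star v ⬝ᵥ (diagonal fun i => algebraMap ℝ F (d i)) *ᵥ v =
      algebraMap ℝ F (∑ i, d i * ‖v i‖ ^ 2) := by
    rw [map_sum]
    refine Finset.sum_congr rfl fun i _ => ?_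
    rw [mulVec_diagonal, map_mul, ← ConjNorm.star_mul_self_eq, Pi.star_apply, ← mul_assoc,
      ← Algebra.commutes, mul_assoc]
  rw [hermForm, this, realPart_algebraMap]

theorem hermForm_one {N : ℕ} (v : Fin N → F) :
    hermForm (1 : Matrix (Fin N) (Fin N) F) v = normSqVec v := by
  rw [hermForm, one_mulVec, star_dotProduct_self, realPart_algebraMap]

theorem hermForm_conjTranspose_mul_self {n N : ℕ} (M : Matrix (Fin n) (Fin N) F)
    (v : Fin N → F) : hermForm (Mᴴ * M) v = normSqVec (M *ᵥ v) := by
  have := hermForm_conjTranspose_mul_mul M 1 v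
  rwa [Matrix.mul_one, hermForm_one] at this

theorem normSqVec_mulVec_of_isometry {n N : ℕ} {k : Matrix (Fin n) (Fin N) F} (hk : kᴴ * k = 1)
    (v : Fin N → F) : normSqVec (k *ᵥ v) = normSqVec v := by
  rw [← hermForm_conjTranspose_mul_self, hk, hermForm_one]

section UnitaryConj

variable {N : ℕ} {U : Matrix (Fin N) (Fin N) F}

theorem isHermitian_unitaryConj (U : Matrix (Fin N) (Fin N) F) (d : Fin N → ℝ) :
    (unitaryConj U d).IsHermitian := by
  have : (diagonal fun i => algebraMap ℝ F (d i))ᴴ = diagonal fun i => algebraMap ℝ F (d i) := by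
    rw [diagonal_conjTranspose]
    congr 1
    funext i
    exact star_algebraMap _
  rw [IsHermitian, unitaryConj, conjTranspose_mul, conjTranspose_mul, conjTranspose_conjTranspose,
    this, Matrix.mul_assoc]

theorem hermForm_unitaryConj (U : Matrix (Fin N) (Fin N) F) (d : Fin N → ℝ) (v : Fin N → F) :
    hermForm (unitaryConj U d) v = ∑ i, d i * ‖(Uᴴ *ᵥ v) i‖ ^ 2 := by
  have := hermForm_conjTranspose_mul_mul Uᴴ (diagonal fun i => algebraMap ℝ F (d i)) v
  rwa [conjTranspose_conjTranspose, hermForm_diagonal] at this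

omit [ConjNorm F] in
theorem unitaryConj_mul (hU : Uᴴ * U = 1) (d d' : Fin N → ℝ) :
    unitaryConj U d * unitaryConj U d' = unitaryConj U (d * d') := by
  have : (diagonal fun i => algebraMap ℝ F (d i)) * (diagonal fun i => algebraMap ℝ F (d' i)) =
      diagonal fun i => algebraMap ℝ F ((d * d') i) := by
    rw [diagonal_mul_diagonal]
    simp
  calc _ = U * (diagonal fun i => algebraMap ℝ F (d i)) * (Uᴴ * U) *
        (diagonal fun i => algebraMap ℝ F (d' i)) * Uᴴ := by
        simp only [unitaryConj, Matrix.mul_assoc]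
    _ = _ := by
        rw [hU, Matrix.mul_one, unitaryConj, ← this]
        simp only [Matrix.mul_assoc]

omit [ConjNorm F] in
/-- The values of `detR` at `U` and at `U†` multiply to `1`. -/
theorem detR_unitaryConj [FiniteDimensional ℝ F] (hU : Uᴴ * U = 1) (d : Fin N → ℝ) :
    detR (unitaryConj U d) = (∏ i, d i) ^ beta F := by
  have h := detR_mul Uᴴ U
  rw [hU, detR_one] at h
  rw [unitaryConj, detR_mul, detR_mul, detR_diagonal, mul_right_comm, mul_comm (detR U), ← h,
    one_mul]

omit [ConjNorm F] in
theorem unitaryConj_mulVec_eq_smul_iff (hU : Uᴴ * U = 1) (d : Fin N → ℝ) (l : ℝ) (v : Fin N → F) :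
    unitaryConj U d *ᵥ v = l • v ↔ ∀ i, d i ≠ l → (Uᴴ *ᵥ v) i = 0 := by
  have hU' := mul_conjTranspose_of_conjTranspose_mul hU
  have h1 : unitaryConj U d *ᵥ v = l • v ↔
      (diagonal fun i => algebraMap ℝ F (d i)) *ᵥ (Uᴴ *ᵥ v) = l • (Uᴴ *ᵥ v) := by
    constructor
    · intro h
      have := congrArg (fun w => Uᴴ *ᵥ w) h
      simp only [mulVec_smul] at this
      rw [← this, unitaryConj, mulVec_mulVec, mulVec_mulVec, Matrix.mul_assoc, ← Matrix.mul_assoc,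
        hU, Matrix.one_mul]
    · intro h
      have := congrArg (fun w => U *ᵥ w) h
      simp only [mulVec_smul] at this
      rwa [mulVec_mulVec, mulVec_mulVec, mulVec_mulVec, hU', one_mulVec] at this
  rw [h1, funext_iff]
  refine forall_congr' fun i => ?_
  rw [mulVec_diagonal, Pi.smul_apply, Algebra.smul_def, ← sub_eq_zero, ← sub_mul, ← map_sub,
    mul_eq_zero, map_eq_zero_iff _ (algebraMap ℝ F).injective, sub_eq_zero]
  tauto

theorem unitaryConj_mem_posHermitian_iff (hU : Uᴴ * U = 1) {d : Fin N → ℝ} :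
    unitaryConj U d ∈ posHermitian F N ↔ ∀ i, 0 ≤ d i := by
  have hU' := mul_conjTranspose_of_conjTranspose_mul hU
  constructor
  · rintro ⟨-, h⟩ i
    have e : Uᴴ *ᵥ (U *ᵥ Pi.single i (1 : F)) = Pi.single i 1 := by
      rw [mulVec_mulVec, hU, one_mulVec]
    refine h (d i) (U *ᵥ Pi.single i 1) (fun h0 => ?_) ?_
    · rw [h0, mulVec_zero] at e
      simpa using congrFun e i
    · rw [unitaryConj_mulVec_eq_smul_iff hU, e]
      intro j hj
      exact Pi.single_eq_of_ne (fun hji => hj (by rw [hji])) _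
  · intro h
    refine ⟨isHermitian_unitaryConj U d, fun l v hv hl => ?_⟩
    rw [unitaryConj_mulVec_eq_smul_iff hU] at hl
    by_contra hneg
    refine hv ?_
    have : Uᴴ *ᵥ v = 0 := funext fun i => hl i fun hi => hneg (hi ▸ h i)
    rw [← one_mulVec v, ← hU', ← mulVec_mulVec, this, mulVec_zero]

omit [ConjNorm F] in
/-- The eigenspace of `U diag(d) U†` for the eigenvalue `l` is a copy of `F ^ {i | d i = l}`. -/
theorem finrank_eigenspace_unitaryConj [FiniteDimensional ℝ F] (hU : Uᴴ * U = 1) (d : Fin N → ℝ)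
    (l : ℝ) : Module.finrank ℝ ((mulVecReal (unitaryConj U d)).eigenspace l) =
      (Finset.univ.filter fun i => d i = l).card * beta F := by
  classical
  have hU' := mul_conjTranspose_of_conjTranspose_mul hU
  have hmem : ∀ v, v ∈ (mulVecReal (unitaryConj U d)).eigenspace l ↔
      ∀ i, d i ≠ l → (Uᴴ *ᵥ v) i = 0 := fun v => by
    rw [← unitaryConj_mulVec_eq_smul_iff hU, Module.End.mem_eigenspace_iff]
    rfl
  let ext : ({i // d i = l} → F) → Fin N → F := fun y i => if h : d i = l then y ⟨i, h⟩ else 0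
  let f : (mulVecReal (unitaryConj U d)).eigenspace l ≃ₗ[ℝ] ({i // d i = l} → F) :=
    { toFun := fun v i => (Uᴴ *ᵥ (v : Fin N → F)) i
      map_add' := fun v w => by
        funext i; simp [mulVec_add]
      map_smul' := fun c v => by
        funext i; simp [mulVec_smul]
      invFun := fun y => ⟨U *ᵥ ext y, by
        rw [hmem, mulVec_mulVec, hU, one_mulVec]
        intro i hi
        simp [ext, hi]⟩
      left_inv := fun v => by
        apply Subtype.ext
        have : ext (fun i => (Uᴴ *ᵥ (v : Fin N → F)) i) = Uᴴ *ᵥ (v : Fin N → F) := by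
          funext i
          by_cases hi : d i = l
          · simp [ext, hi]
          · simp [ext, hi, (hmem v).1 v.2 i hi]
        simp only [this]
        rw [mulVec_mulVec, hU', one_mulVec]
      right_inv := fun y => by
        funext i
        simp only
        rw [mulVec_mulVec, hU, one_mulVec]
        simp [ext, i.2] }
  rw [f.finrank_eq, Module.finrank_pi_fintype, Finset.sum_const, Finset.card_univ,
    Fintype.card_subtype, smul_eq_mul, beta]

omit [ConjNorm F] in
theorem hermitianDet_unitaryConj [FiniteDimensional ℝ F] (hU : Uᴴ * U = 1) (d : Fin N → ℝ) :
    hermitianDet (unitaryConj U d) = ∏ i, d i := by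
  classical
  have h1 : ∀ l, Module.finrank ℝ ((mulVecReal (unitaryConj U d)).eigenspace l) / beta F =
      (Finset.univ.filter fun i => d i = l).card := fun l => by
    rw [finrank_eigenspace_unitaryConj hU, Nat.mul_div_cancel _ beta_pos]
  simp only [hermitianDet, h1]
  rw [finprod_eq_prod_of_mulSupport_subset (s := Finset.univ.image d)]
  · exact (Finset.prod_comp (fun x : ℝ => x) d).symm
  · intro l hl
    rw [Function.mem_mulSupport] at hl
    by_contra h
    refine hl ?_
    rw [Finset.card_eq_zero.2, pow_zero]
    rw [Finset.filter_eq_empty_iff]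
    intro i _ hi
    exact h (by simpa using ⟨i, hi⟩)

end UnitaryConj

variable [FiniteDimensional ℝ F] {N : ℕ} {W : Matrix (Fin N) (Fin N) F}

theorem exists_eq_unitaryConj_of_mem (hW : W ∈ posHermitian F N) :
    ∃ (U : Matrix (Fin N) (Fin N) F) (d : Fin N → ℝ), Uᴴ * U = 1 ∧ (∀ i, 0 ≤ d i) ∧
      W = unitaryConj U d := by
  obtain ⟨U, d, hU, rfl⟩ := exists_eq_unitaryConj hW.1
  exact ⟨U, d, hU, (unitaryConj_mem_posHermitian_iff hU).1 hW, rfl⟩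

/-- Non-negativity of the eigenvalues is non-negativity of the Hermitian form. -/
theorem mem_posHermitian_iff :
    W ∈ posHermitian F N ↔ W.IsHermitian ∧ ∀ v, 0 ≤ hermForm W v := by
  constructor
  · intro h
    obtain ⟨U, d, hU, hd, rfl⟩ := exists_eq_unitaryConj_of_mem h
    refine ⟨h.1, fun v => ?_⟩
    rw [hermForm_unitaryConj]
    exact Finset.sum_nonneg fun i _ => mul_nonneg (hd i) (sq_nonneg _)
  · rintro ⟨h, h'⟩
    refine ⟨h, fun l v hv hl => ?_⟩
    have := h' v
    rw [hermForm, hl, dotProduct_smul, star_dotProduct_self, realPart_smul,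
      realPart_algebraMap] at this
    exact nonneg_of_mul_nonneg_left this (normSqVec_pos hv)

theorem conjTranspose_mul_self_mem_posHermitian {n : ℕ} (M : Matrix (Fin n) (Fin N) F) :
    Mᴴ * M ∈ posHermitian F N :=
  mem_posHermitian_iff.2 ⟨isHermitian_conjTranspose_mul_self M, fun v => by
    rw [hermForm_conjTranspose_mul_self]
    exact normSqVec_nonneg _⟩

/-- The positive definite Hermitian matrices. -/
def posDefHermitian (F : Type*) [NormedDivisionRing F] [NormedAlgebra ℝ F] [StarRing F] (N : ℕ) :
    Set (Matrix (Fin N) (Fin N) F) :=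
  {W | W.IsHermitian ∧ ∀ v, v ≠ 0 → 0 < realPart (star v ⬝ᵥ W *ᵥ v)}

theorem detR_nonneg (hW : W ∈ posHermitian F N) : 0 ≤ detR W := by
  obtain ⟨U, d, hU, hd, rfl⟩ := exists_eq_unitaryConj_of_mem hW
  rw [detR_unitaryConj hU]
  exact pow_nonneg (Finset.prod_nonneg fun i _ => hd i) _

/-- The real determinant is the `β`-th power of the product of the eigenvalues. -/
theorem hermitianDet_eq_detR_rpow (hW : W ∈ posHermitian F N) :
    hermitianDet W = detR W ^ (1 / (beta F : ℝ)) := by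
  obtain ⟨U, d, hU, hd, rfl⟩ := exists_eq_unitaryConj_of_mem hW
  rw [detR_unitaryConj hU, hermitianDet_unitaryConj hU, one_div,
    Real.pow_rpow_inv_natCast (Finset.prod_nonneg fun i _ => hd i) beta_pos.ne']

theorem mem_posDefHermitian_iff :
    W ∈ posDefHermitian F N ↔ W ∈ posHermitian F N ∧ detR W ≠ 0 := by
  constructor
  · rintro ⟨h, h'⟩
    have hpos : W ∈ posHermitian F N := mem_posHermitian_iff.2 ⟨h, fun v => by
      rcases eq_or_ne v 0 with rfl | hv
      · simp [hermForm, realPart]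
      · exact (h' v hv).le⟩
    refine ⟨hpos, fun hdet => ?_⟩
    obtain ⟨v, hv, hv0⟩ := Submodule.exists_mem_ne_zero_of_ne_bot
      (LinearMap.bot_lt_ker_of_det_eq_zero hdet).ne'
    have h0 : W *ᵥ v = 0 := hv
    have := h' v hv0
    rw [h0, dotProduct_zero] at this
    simp [realPart] at this
  · rintro ⟨h, hdet⟩
    obtain ⟨U, d, hU, hd, rfl⟩ := exists_eq_unitaryConj_of_mem h
    rw [detR_unitaryConj hU] at hdet
    have hd' : ∀ i, 0 < d i := fun i => (hd i).lt_of_ne fun hi =>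
      hdet (by rw [Finset.prod_eq_zero (Finset.mem_univ i) hi.symm, zero_pow beta_pos.ne'])
    refine ⟨h.1, fun v hv => ?_⟩
    have hv' : Uᴴ *ᵥ v ≠ 0 := fun h0 => hv (by
      rw [← one_mulVec v, ← mul_conjTranspose_of_conjTranspose_mul hU, ← mulVec_mulVec, h0,
        mulVec_zero])
    obtain ⟨i, hi⟩ := Function.ne_iff.1 hv'
    have := hermForm_unitaryConj U d v
    rw [hermForm] at this
    rw [this]
    refine Finset.sum_pos' (fun i _ => mul_nonneg (hd i) (sq_nonneg _)) ⟨i, Finset.mem_univ _, ?_⟩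
    exact mul_pos (hd' i) (pow_pos (norm_pos_iff.2 hi) 2)

/-! ### The square root and the polar decomposition -/

theorem exists_posHermitian_mul_self (hW : W ∈ posHermitian F N) :
    ∃ P ∈ posHermitian F N, P * P = W := by
  obtain ⟨U, d, hU, hd, rfl⟩ := exists_eq_unitaryConj_of_mem hW
  refine ⟨unitaryConj U fun i => √(d i),
    (unitaryConj_mem_posHermitian_iff hU).2 fun i => Real.sqrt_nonneg _, ?_⟩
  rw [unitaryConj_mul hU]
  congr 1
  funext i
  exact Real.mul_self_sqrt (hd i)

/-- Uniqueness of the positive square root. In eigenbases of `P` and `Q` the equation `P² = Q²`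
says that a matrix `X` satisfies `dᵢ² Xᵢⱼ = Xᵢⱼ eⱼ²`, hence also `dᵢ Xᵢⱼ = Xᵢⱼ eⱼ`. -/
theorem posHermitian_mul_self_injective {P Q : Matrix (Fin N) (Fin N) F}
    (hP : P ∈ posHermitian F N) (hQ : Q ∈ posHermitian F N) (h : P * P = Q * Q) : P = Q := by
  obtain ⟨U, d, hU, hd, rfl⟩ := exists_eq_unitaryConj_of_mem hP
  obtain ⟨V, e, hV, he, rfl⟩ := exists_eq_unitaryConj_of_mem hQ
  have hU' := mul_conjTranspose_of_conjTranspose_mul hU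
  have hV' := mul_conjTranspose_of_conjTranspose_mul hV
  have key : ∀ a b : Fin N → ℝ, unitaryConj U a = unitaryConj V b ↔
      ∀ i j, (a i - b j) • (Uᴴ * V) i j = 0 := by
    intro a b
    have h1 : unitaryConj U a = unitaryConj V b ↔
        (diagonal fun i => algebraMap ℝ F (a i)) * (Uᴴ * V) =
          (Uᴴ * V) * (diagonal fun i => algebraMap ℝ F (b i)) := by
      constructor
      · intro h
        have h2 := congrArg (fun X => Uᴴ * X * V) h
        calc _ = (Uᴴ * U) * (diagonal fun i => algebraMap ℝ F (a i)) * Uᴴ * V := by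
              rw [hU, Matrix.one_mul, Matrix.mul_assoc]
          _ = Uᴴ * unitaryConj U a * V := by simp only [unitaryConj, Matrix.mul_assoc]
          _ = Uᴴ * V * (diagonal fun i => algebraMap ℝ F (b i)) * (Vᴴ * V) := by
              rw [h]; simp only [unitaryConj, Matrix.mul_assoc]
          _ = _ := by rw [hV, Matrix.mul_one]
      · intro h
        calc unitaryConj U a
            = U * ((diagonal fun i => algebraMap ℝ F (a i)) * (Uᴴ * V)) * Vᴴ := by
              rw [unitaryConj, ← Matrix.mul_one (U * _ * Uᴴ), ← hV']
              simp only [Matrix.mul_assoc]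
          _ = (U * Uᴴ) * V * (diagonal fun i => algebraMap ℝ F (b i)) * Vᴴ := by
              rw [h]; simp only [Matrix.mul_assoc]
          _ = _ := by rw [hU', Matrix.one_mul, unitaryConj]
    rw [h1, ← Matrix.ext_iff]
    refine forall_congr' fun i => forall_congr' fun j => ?_
    rw [diagonal_mul, mul_diagonal, sub_smul, sub_eq_zero, Algebra.smul_def, Algebra.smul_def,
      Algebra.commutes (b j)]
  rw [unitaryConj_mul hU, unitaryConj_mul hV, key] at h
  rw [key]
  intro i j
  rcases smul_eq_zero.1 (h i j) with h | h
  · have h' : d i * d i = e j * e j := sub_eq_zero.1 h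
    rw [(mul_self_inj (hd i) (he j)).1 h', sub_self, zero_smul]
  · rw [h, smul_zero]

theorem hermitianSqrt_mem (hW : W ∈ posHermitian F N) : hermitianSqrt W ∈ posHermitian F N := by
  have h := exists_posHermitian_mul_self hW
  rw [hermitianSqrt, dif_pos h]
  exact h.choose_spec.1

theorem hermitianSqrt_mul_self (hW : W ∈ posHermitian F N) :
    hermitianSqrt W * hermitianSqrt W = W := by
  have h := exists_posHermitian_mul_self hW
  rw [hermitianSqrt, dif_pos h]
  exact h.choose_spec.2

theorem mul_self_mem_posHermitian {P : Matrix (Fin N) (Fin N) F} (hP : P ∈ posHermitian F N) :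
    P * P ∈ posHermitian F N := by
  have := conjTranspose_mul_self_mem_posHermitian P
  rwa [hP.1.eq] at this

theorem hermitianSqrt_eq {P : Matrix (Fin N) (Fin N) F} (hP : P ∈ posHermitian F N) :
    hermitianSqrt (P * P) = P :=
  posHermitian_mul_self_injective (hermitianSqrt_mem (mul_self_mem_posHermitian hP)) hP
    (hermitianSqrt_mul_self (mul_self_mem_posHermitian hP))

/-- The polar decomposition, for `M` of any rank. -/
theorem exists_polar {n : ℕ} (hNn : N ≤ n) (M : Matrix (Fin n) (Fin N) F) :
    ∃ U : stiefel F n N, M = (U : Matrix (Fin n) (Fin N) F) * hermitianSqrt (Mᴴ * M) := by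
  obtain ⟨U, d, hU, hd, hM⟩ :=
    exists_eq_unitaryConj_of_mem (conjTranspose_mul_self_mem_posHermitian M)
  have hU' := mul_conjTranspose_of_conjTranspose_mul hU
  have hA : (M * U)ᴴ * (M * U) = diagonal fun i => algebraMap ℝ F (d i) := by
    calc _ = Uᴴ * (Mᴴ * M) * U := by simp only [conjTranspose_mul, Matrix.mul_assoc]
      _ = (Uᴴ * U) * (diagonal fun i => algebraMap ℝ F (d i)) * (Uᴴ * U) := by
        rw [hM]; simp only [unitaryConj, Matrix.mul_assoc]
      _ = _ := by rw [hU, Matrix.one_mul, Matrix.mul_one]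
  -- The columns of `M * U` are orthogonal with squared norms `d`; the nonzero ones are normalised,
  -- and completed to an orthonormal family.
  let a : Fin N → Fin n → F := fun j i => (M * U) i j
  have ha : ∀ i j, star (a i) ⬝ᵥ a j = if i = j then algebraMap ℝ F (d i) else 0 := fun i j => by
    have := congrFun (congrFun hA i) j
    rw [diagonal_apply] at this
    rw [← this]
    rfl
  have ho : OrthonormalOn (fun j => (√(d j))⁻¹ • a j) (Finset.univ.filter fun j => d j ≠ 0) := by
    intro i hi j hj
    have hi : d i ≠ 0 := (Finset.mem_filter.1 hi).2
    simp only [star_smul, star_trivial, smul_dotProduct, dotProduct_smul, ha]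
    by_cases hij : i = j
    · subst hij
      rw [if_pos rfl, if_pos rfl, smul_smul, ← mul_inv, Real.mul_self_sqrt (hd i), Algebra.smul_def,
        ← map_mul, inv_mul_cancel₀ hi, map_one]
    · rw [if_neg hij, if_neg hij, smul_zero, smul_zero]
  obtain ⟨e, he, hea⟩ := ho.exists_extension hNn
  have hV := he.conjTranspose_mul_self
  have hMU : M * U = (of e)ᵀ * diagonal fun i => algebraMap ℝ F (√(d i)) := by
    ext i j
    rw [mul_diagonal]
    change a j i = e j i * _
    rw [← Algebra.commutes, ← Algebra.smul_def]
    by_cases hj : d j = 0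
    · have h0 := ha j j
      rw [if_pos rfl, hj, star_dotProduct_self] at h0
      rw [normSqVec_eq_zero.1 ((algebraMap ℝ F).injective h0), hj]
      simp
    · rw [hea j (by simp [hj]), Pi.smul_apply, smul_smul, mul_inv_cancel₀, one_smul]
      rw [Real.sqrt_ne_zero (hd j)]
      exact hj
  refine ⟨⟨(of e)ᵀ * Uᴴ, ?_⟩, ?_⟩
  · calc _ = U * (((of e)ᵀ)ᴴ * (of e)ᵀ) * Uᴴ := by
          rw [conjTranspose_mul, conjTranspose_conjTranspose]; simp only [Matrix.mul_assoc]
      _ = 1 := by rw [hV, Matrix.mul_one, hU']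
  · have hs : hermitianSqrt (Mᴴ * M) = unitaryConj U fun i => √(d i) := by
      have hP : unitaryConj U (fun i => √(d i)) ∈ posHermitian F N :=
        (unitaryConj_mem_posHermitian_iff hU).2 fun i => Real.sqrt_nonneg _
      rw [← hermitianSqrt_eq hP, unitaryConj_mul hU, hM]
      congr 2
      funext i
      exact (Real.mul_self_sqrt (hd i)).symm
    calc M = M * U * Uᴴ := by rw [Matrix.mul_assoc, hU', Matrix.mul_one]
      _ = (of e)ᵀ * (Uᴴ * U) * (diagonal fun i => algebraMap ℝ F (√(d i))) * Uᴴ := by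
        rw [hMU, hU, Matrix.mul_one]
      _ = _ := by rw [hs]; simp only [unitaryConj, Matrix.mul_assoc]

end Positive

/-! ### Bordered matrices and the Schur complement -/

section Border

variable {F : Type*}

/-- The matrix `[A u; w t]`, with last column `(u, t)` and last row `(w, t)`. -/
def border {N : ℕ} (A : Matrix (Fin N) (Fin N) F) (u w : Fin N → F) (t : F) :
    Matrix (Fin (N + 1)) (Fin (N + 1)) F :=
  Fin.snoc (α := fun _ => Fin (N + 1) → F) (fun i => Fin.snoc (α := fun _ => F) (A i) (u i))
    (Fin.snoc (α := fun _ => F) w t)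

variable {N : ℕ} (A : Matrix (Fin N) (Fin N) F) (u w : Fin N → F) (t : F)

@[simp] theorem border_castSucc_castSucc (i j : Fin N) :
    border A u w t i.castSucc j.castSucc = A i j := by simp [border]

@[simp] theorem border_castSucc_last (i : Fin N) :
    border A u w t i.castSucc (Fin.last N) = u i := by simp [border]

@[simp] theorem border_last_castSucc (j : Fin N) :
    border A u w t (Fin.last N) j.castSucc = w j := by simp [border]

@[simp] theorem border_last_last : border A u w t (Fin.last N) (Fin.last N) = t := by
  simp [border]

variable {A u w t} in
theorem eq_border_iff {X : Matrix (Fin (N + 1)) (Fin (N + 1)) F} :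
    X = border A u w t ↔ (∀ i j : Fin N, X i.castSucc j.castSucc = A i j) ∧
      (∀ i : Fin N, X i.castSucc (Fin.last N) = u i) ∧
      (∀ j : Fin N, X (Fin.last N) j.castSucc = w j) ∧ X (Fin.last N) (Fin.last N) = t := by
  constructor
  · rintro rfl
    simp
  · rintro ⟨h1, h2, h3, h4⟩
    ext i j
    induction i using Fin.lastCases <;> induction j using Fin.lastCases <;> simp [*]

end Border

section Bordered

variable {F : Type*} [NormedDivisionRing F] [NormedAlgebra ℝ F] [StarRing F] [ConjNorm F]

/-- The matrix `[M v]`, with last column `v`. -/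
def appendCol {n N : ℕ} (M : Matrix (Fin n) (Fin N) F) (v : Fin n → F) :
    Matrix (Fin n) (Fin (N + 1)) F :=
  fun i => Fin.snoc (α := fun _ => F) (M i) (v i)

/-- The matrix `[W u; u† t]` with `t` real, Hermitian if `W` is. -/
def hermBlock {N : ℕ} (W : Matrix (Fin N) (Fin N) F) (u : Fin N → F) (t : ℝ) :
    Matrix (Fin (N + 1)) (Fin (N + 1)) F :=
  border W u (star u) (algebraMap ℝ F t)

section

variable {N : ℕ} (A B : Matrix (Fin N) (Fin N) F) (u w u' w' : Fin N → F) (t t' : F)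

omit [NormedAlgebra ℝ F] [StarRing F] [ConjNorm F] in
theorem border_mul_border : border A u w t * border B u' w' t' =
    border (A * B + vecMulVec u w') (A *ᵥ u' + MulOpposite.op t' • u)
      (w ᵥ* B + t • w') (w ⬝ᵥ u' + t * t') := by
  rw [eq_border_iff]
  simp [mul_apply, Fin.sum_univ_castSucc, vecMulVec_apply, mulVec, vecMul, dotProduct]

omit [NormedAlgebra ℝ F] [ConjNorm F] in
theorem conjTranspose_border :
    (border A u w t)ᴴ = border Aᴴ (star w) (star u) (star t) := by
  rw [eq_border_iff]
  simp

omit [StarRing F] [ConjNorm F] in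
theorem border_eq_diagonal (d : Fin N → ℝ) (r : ℝ) :
    border (diagonal fun i => algebraMap ℝ F (d i)) 0 0 (algebraMap ℝ F r) =
      diagonal fun i => algebraMap ℝ F (Fin.snoc (α := fun _ => ℝ) d r i) := by
  symm
  rw [eq_border_iff]
  simp [diagonal_apply, Fin.castSucc_ne_last, (Fin.castSucc_ne_last _).symm]

omit [StarRing F] [ConjNorm F] in
theorem border_one_eq_diagonal (r : ℝ) :
    border (1 : Matrix (Fin N) (Fin N) F) 0 0 (algebraMap ℝ F r) =
      diagonal fun i => algebraMap ℝ F (Fin.snoc (α := fun _ => ℝ) 1 r i) := by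
  rw [← border_eq_diagonal]
  simp [← diagonal_one]

omit [NormedAlgebra ℝ F] [StarRing F] [ConjNorm F] in
theorem border_one : border (1 : Matrix (Fin N) (Fin N) F) 0 0 1 = 1 := by
  symm
  rw [eq_border_iff]
  simp [one_apply, Fin.castSucc_ne_last, (Fin.castSucc_ne_last _).symm]

omit [StarRing F] [ConjNorm F] in
theorem detR_border_scalar [FiniteDimensional ℝ F] (r : ℝ) :
    detR (border (1 : Matrix (Fin N) (Fin N) F) 0 0 (algebraMap ℝ F r)) = r ^ beta F := by
  rw [border_one_eq_diagonal, detR_diagonal, Fin.prod_univ_castSucc]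
  simp

omit [StarRing F] [ConjNorm F] in
/-- An invertible matrix whose square is conjugate to itself has determinant one. -/
theorem detR_eq_one_of_conj {T T' G G' : Matrix (Fin N) (Fin N) F} (hT : T * T' = 1)
    (hG : G * G' = 1) (h : G * T * G' = T * T) : detR T = 1 := by
  have h1 := congrArg detR hT
  have h2 := congrArg detR hG
  have h3 := congrArg detR h
  simp only [detR_mul, detR_one] at h1 h2 h3
  apply mul_left_cancel₀ (left_ne_zero_of_mul_eq_one h1)
  rw [← h3, mul_one, mul_right_comm, h2, one_mul]

omit [StarRing F] [ConjNorm F] in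
theorem border_scalar_mul_inv :
    border (1 : Matrix (Fin N) (Fin N) F) 0 0 (algebraMap ℝ F 2⁻¹) *
      border 1 0 0 (algebraMap ℝ F 2) = 1 := by
  rw [border_mul_border, ← border_one]
  congr 1 <;> (try ext) <;> simp

omit [StarRing F] [ConjNorm F] in
/-- The square of the unipotent matrix `T_x = [1 x; 0 1]` is `T_{2 x}`, a conjugate of `T_x`. -/
theorem detR_border_unipotent [FiniteDimensional ℝ F] (x : Fin N → F) :
    detR (border (1 : Matrix (Fin N) (Fin N) F) x 0 1) = 1 := by
  refine detR_eq_one_of_conj (T' := border 1 (-x) 0 1) ?_ border_scalar_mul_inv ?_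
  · rw [border_mul_border, ← border_one]
    congr 1 <;> (try ext) <;> simp
  · simp only [border_mul_border]
    congr 1 <;> (try ext) <;> simp [map_ofNat, mul_two, inv_two_add_inv_two]

omit [StarRing F] [ConjNorm F] in
/-- The transposed form of `detR_border_unipotent`; transposition does not respect products over
noncommutative scalars, so it is argued separately. -/
theorem detR_border_unipotent' [FiniteDimensional ℝ F] (x : Fin N → F) :
    detR (border (1 : Matrix (Fin N) (Fin N) F) 0 x 1) = 1 := by
  refine detR_eq_one_of_conj (T' := border 1 0 (-x) 1) ?_ (mul_eq_one_comm.1 border_scalar_mul_inv)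
    ?_
  · rw [border_mul_border, ← border_one]
    congr 1 <;> (try ext) <;> simp
  · simp only [border_mul_border]
    congr 1 <;> (try ext) <;> simp [map_ofNat, two_mul, inv_two_add_inv_two]

/-- For positive `S`, the bordered matrix is diagonalised by bordering the unitary matrix that
diagonalises `S`. -/
theorem detR_border_of_posHermitian [FiniteDimensional ℝ F] {S : Matrix (Fin N) (Fin N) F}
    (hS : S ∈ posHermitian F N) : detR (border S 0 0 1) = detR S := by
  obtain ⟨U, d, hU, hd, rfl⟩ := exists_eq_unitaryConj_of_mem hS
  have hU2 : (border U 0 0 1)ᴴ * border U 0 0 1 = 1 := by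
    rw [conjTranspose_border, border_mul_border, ← border_one]
    congr 1 <;> (try ext) <;> simp [hU]
  have h : border (unitaryConj U d) 0 0 1 =
      unitaryConj (border U 0 0 1) (Fin.snoc (α := fun _ => ℝ) d 1) := by
    have hD := border_eq_diagonal (F := F) d 1
    rw [map_one] at hD
    conv_rhs => rw [unitaryConj, ← hD, conjTranspose_border, border_mul_border, border_mul_border]
    congr 1 <;> (try ext) <;> simp [unitaryConj]
  rw [h, detR_unitaryConj hU2, detR_unitaryConj hU, Fin.prod_univ_castSucc]
  simp

end

section

variable {N : ℕ}

/-- Appending a column `v` to `M` borders the Gram matrix by `M† v` and `|v|²`. -/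
theorem appendCol_gram {n : ℕ} (M : Matrix (Fin n) (Fin N) F) (v : Fin n → F) :
    (appendCol M v)ᴴ * appendCol M v = hermBlock (Mᴴ * M) (Mᴴ *ᵥ v) (normSqVec v) := by
  rw [hermBlock, eq_border_iff, ← star_dotProduct_self]
  simp [mul_apply, appendCol, mulVec, dotProduct]

omit [NormedAlgebra ℝ F] [StarRing F] [ConjNorm F] in
/-- The factorisation `[1 x; 0 1] [S 0; 0 1] = [S x; 0 1]`, by which the determinant of the
triangular matrix is that of `S`. -/
theorem border_factor (S : Matrix (Fin N) (Fin N) F) (x : Fin N → F) :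
    border 1 x 0 1 * border S 0 0 1 = border S x 0 1 := by
  rw [border_mul_border]
  congr 1 <;> (try ext) <;> simp

/-- The factorisation `[S² Sx; (Sx)† |x|² + s] = R† diag(1, s) R` with `R = [S x; 0 1]`, in which
`s` is the Schur complement of the block `S²`. -/
theorem hermBlock_eq {S : Matrix (Fin N) (Fin N) F} (hS : S.IsHermitian) (x : Fin N → F) (s : ℝ) :
    hermBlock (S * S) (S *ᵥ x) (normSqVec x + s) =
      (border S x 0 1)ᴴ * border 1 0 0 (algebraMap ℝ F s) * border S x 0 1 := by
  rw [conjTranspose_border, hS.eq, border_mul_border, border_mul_border, hermBlock, map_add,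
    ← star_dotProduct_self, star_mulVec, hS.eq]
  congr 1 <;> (try ext) <;> simp

theorem isHermitian_hermBlock {W : Matrix (Fin N) (Fin N) F} (hW : W.IsHermitian) (u : Fin N → F)
    (t : ℝ) : (hermBlock W u t).IsHermitian := by
  rw [IsHermitian, hermBlock, conjTranspose_border, hW.eq, star_star, star_algebraMap]

omit [ConjNorm F] in
theorem isHermitian_of_hermBlock {W : Matrix (Fin N) (Fin N) F} {u : Fin N → F} {t : ℝ}
    (h : (hermBlock W u t).IsHermitian) : W.IsHermitian := by
  ext i j
  have := congrFun (congrFun h i.castSucc) j.castSucc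
  simpa [hermBlock] using this

omit [ConjNorm F] in
theorem hermForm_hermBlock_snoc_zero (W : Matrix (Fin N) (Fin N) F) (u : Fin N → F) (t : ℝ)
    (v : Fin N → F) :
    hermForm (hermBlock W u t) (Fin.snoc (α := fun _ => F) v 0) = hermForm W v := by
  simp [hermForm, hermBlock, mulVec, dotProduct, Fin.sum_univ_castSucc]

theorem hermForm_hermBlock {S : Matrix (Fin N) (Fin N) F} (hS : S.IsHermitian) (x : Fin N → F)
    (s : ℝ) (v : Fin (N + 1) → F) :
    hermForm (hermBlock (S * S) (S *ᵥ x) (normSqVec x + s)) v =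
      (∑ i : Fin N, ‖(border S x 0 1 *ᵥ v) i.castSucc‖ ^ 2) +
        s * ‖(border S x 0 1 *ᵥ v) (Fin.last N)‖ ^ 2 := by
  rw [hermBlock_eq hS, hermForm_conjTranspose_mul_mul, border_one_eq_diagonal, hermForm_diagonal,
    Fin.sum_univ_castSucc]
  simp

variable [FiniteDimensional ℝ F]

theorem detR_border {S : Matrix (Fin N) (Fin N) F} (hS : S ∈ posHermitian F N) (x : Fin N → F) :
    detR (border S x 0 1) = detR S := by
  rw [← border_factor, detR_mul, detR_border_unipotent, one_mul, detR_border_of_posHermitian hS]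

theorem detR_conjTranspose_border {S : Matrix (Fin N) (Fin N) F} (hS : S ∈ posHermitian F N)
    (x : Fin N → F) : detR (border S x 0 1)ᴴ = detR S := by
  rw [← border_factor, conjTranspose_mul, detR_mul, conjTranspose_border, conjTranspose_border,
    hS.1.eq]
  simp [detR_border_of_posHermitian hS, detR_border_unipotent']

/-- The determinant of a bordered matrix is that of the block times the Schur complement. -/
theorem detR_hermBlock {S : Matrix (Fin N) (Fin N) F} (hS : S ∈ posHermitian F N) (x : Fin N → F)
    (s : ℝ) : detR (hermBlock (S * S) (S *ᵥ x) (normSqVec x + s)) = detR (S * S) * s ^ beta F := by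
  rw [hermBlock_eq hS.1, detR_mul, detR_mul, detR_conjTranspose_border hS, detR_border hS,
    detR_border_scalar, detR_mul]
  ring

theorem mem_posHermitian_of_hermBlock {W : Matrix (Fin N) (Fin N) F} {u : Fin N → F} {t : ℝ}
    (h : hermBlock W u t ∈ posHermitian F (N + 1)) : W ∈ posHermitian F N := by
  rw [mem_posHermitian_iff] at h ⊢
  exact ⟨isHermitian_of_hermBlock h.1, fun v => by
    rw [← hermForm_hermBlock_snoc_zero W u t]
    exact h.2 _⟩

/-- The criterion of Sylvester for a positive definite block `W = S²`: with Schur complement `s`,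
the bordered matrix is positive semidefinite iff `s ≥ 0`. -/
theorem hermBlock_mem_posHermitian_iff {S : Matrix (Fin N) (Fin N) F} (hS : S ∈ posHermitian F N)
    (hdet : detR S ≠ 0) (x : Fin N → F) (s : ℝ) :
    hermBlock (S * S) (S *ᵥ x) (normSqVec x + s) ∈ posHermitian F (N + 1) ↔ 0 ≤ s := by
  rw [mem_posHermitian_iff]
  constructor
  · rintro ⟨-, h⟩
    have hR : LinearMap.det (mulVecReal (border S x 0 1)) ≠ 0 := by
      rwa [← detR, detR_border hS]
    obtain ⟨v, hv⟩ := (LinearMap.equivOfDetNeZero _ hR).surjective (Pi.single (Fin.last N) 1)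
    have hv' : border S x 0 1 *ᵥ v = Pi.single (Fin.last N) 1 := hv
    have := h v
    rw [hermForm_hermBlock hS.1, hv'] at this
    simpa [Fin.castSucc_ne_last] using this
  · intro hs
    refine ⟨isHermitian_hermBlock (mul_self_mem_posHermitian hS).1 _ _, fun v => ?_⟩
    rw [hermForm_hermBlock hS.1]
    positivity

theorem hermBlock_mem_posDefHermitian_iff {S : Matrix (Fin N) (Fin N) F}
    (hS : S ∈ posHermitian F N) (hdet : detR S ≠ 0) (x : Fin N → F) (s : ℝ) :
    hermBlock (S * S) (S *ᵥ x) (normSqVec x + s) ∈ posDefHermitian F (N + 1) ↔ 0 < s := by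
  rw [mem_posDefHermitian_iff, hermBlock_mem_posHermitian_iff hS hdet, detR_hermBlock hS, detR_mul,
    lt_iff_le_and_ne]
  refine and_congr_right fun _ => ?_
  simp [hdet, (beta_pos (F := F)).ne', eq_comm]

end

omit [ConjNorm F] in
theorem mem_posDefHermitian_of_hermBlock {N : ℕ} {W : Matrix (Fin N) (Fin N) F} {u : Fin N → F}
    {t : ℝ} (h : hermBlock W u t ∈ posDefHermitian F (N + 1)) : W ∈ posDefHermitian F N := by
  refine ⟨isHermitian_of_hermBlock h.1, fun v hv => ?_⟩
  have := h.2 (Fin.snoc (α := fun _ => F) v 0) fun h0 => hv (funext fun i => by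
    have := congrFun h0 i.castSucc
    simpa using this)
  rwa [← hermForm, hermForm_hermBlock_snoc_zero] at this

end Bordered

/-! ### The density of the Gram matrix -/

section Density

variable {F : Type*} [NormedDivisionRing F] [NormedAlgebra ℝ F] [StarRing F]

/-- The density of the Gram matrix with respect to Lebesgue measure on Hermitian matrices, on
positive definite matrices and in terms of the real determinant, which is the `β`-th power of the
determinant. -/
def gramDensity (F : Type*) [NormedDivisionRing F] [NormedAlgebra ℝ F] [StarRing F] (n N : ℕ)
    (W : Matrix (Fin N) (Fin N) F) : ENNReal :=
  (posDefHermitian F N).indicator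
    (fun W => ENNReal.ofReal (detR W ^ (((n : ℝ) - N + 1) / 2 - 1 / (beta F : ℝ)))) W

theorem gramDensity_lt_top {n N : ℕ} (W : Matrix (Fin N) (Fin N) F) :
    gramDensity F n N W < ⊤ := by
  unfold gramDensity Set.indicator
  split_ifs
  · exact ENNReal.ofReal_lt_top
  · exact ENNReal.zero_lt_top

variable [ConjNorm F] [FiniteDimensional ℝ F]

/-- The density splits into a power of the determinant of the block `S²` and the weight of the Schur
complement `s`; the latter is the one of the radial integration formula in `F ^ m`. -/
theorem gramDensity_hermBlock {m N : ℕ} {S : Matrix (Fin N) (Fin N) F} (hS : S ∈ posHermitian F N)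
    (hdet : detR S ≠ 0) (x : Fin N → F) {s : ℝ} :
    gramDensity F (N + m) (N + 1) (hermBlock (S * S) (S *ᵥ x) (normSqVec x + s)) =
      ENNReal.ofReal (detR (S * S) ^ ((m : ℝ) / 2 - 1 / (beta F : ℝ))) *
        (Set.Ioi 0).indicator (fun s => ENNReal.ofReal (s ^ ((beta F : ℝ) * m / 2 - 1))) s := by
  have hβ : (beta F : ℝ) ≠ 0 := Nat.cast_ne_zero.2 beta_pos.ne'
  rw [gramDensity]
  by_cases hs : 0 < s
  · rw [Set.indicator_of_mem ((hermBlock_mem_posDefHermitian_iff hS hdet x s).2 hs),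
      Set.indicator_of_mem (Set.mem_Ioi.2 hs), detR_hermBlock hS,
      ← ENNReal.ofReal_mul (Real.rpow_nonneg (detR_nonneg (mul_self_mem_posHermitian hS)) _),
      Real.mul_rpow (detR_nonneg (mul_self_mem_posHermitian hS)) (pow_nonneg hs.le _),
      ← Real.rpow_natCast s, ← Real.rpow_mul hs.le]
    congr 3
    · push_cast; ring
    · push_cast; field_simp; ring
  · rw [Set.indicator_of_notMem (fun h => hs ((hermBlock_mem_posDefHermitian_iff hS hdet x s).1 h)),
      Set.indicator_of_notMem (s := Set.Ioi (0 : ℝ)) hs, mul_zero]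

/-- The density for `N` columns cancels the power of `det W` that arises when a column is added. -/
theorem gramDensity_mul_rpow {N m : ℕ} {W : Matrix (Fin N) (Fin N) F}
    (hW : W ∈ posDefHermitian F N) : gramDensity F (N + m) N W *
      ENNReal.ofReal (detR W ^ (-(1 / 2 : ℝ) - ((m : ℝ) / 2 - 1 / (beta F : ℝ)))) = 1 := by
  obtain ⟨hpos, hdet⟩ := mem_posDefHermitian_iff.1 hW
  have h0 : 0 < detR W := (detR_nonneg hpos).lt_of_ne hdet.symm
  rw [gramDensity, Set.indicator_of_mem hW, ← ENNReal.ofReal_mul (Real.rpow_nonneg h0.le _),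
    ← Real.rpow_add h0]
  have : ((↑(N + m) : ℝ) - N + 1) / 2 - 1 / (beta F : ℝ) +
      (-(1 / 2) - ((m : ℝ) / 2 - 1 / (beta F : ℝ))) = 0 := by
    push_cast; ring
  rw [this, Real.rpow_zero, ENNReal.ofReal_one]

theorem gramDensity_eq_zero {n N : ℕ} {W : Matrix (Fin N) (Fin N) F} (hW : W ∉ posHermitian F N) :
    gramDensity F n N W = 0 := by
  exact Set.indicator_of_notMem (fun h => hW (mem_posDefHermitian_iff.1 h).1) _

/-- In terms of the determinant the density is the weight of the integration formula. -/
theorem toReal_gramDensity {n N : ℕ} {W : Matrix (Fin N) (Fin N) F}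
    (hW : W ∈ posDefHermitian F N) : (gramDensity F n N W).toReal =
      hermitianDet W ^ ((beta F : ℝ) * ((n : ℝ) - (N : ℝ) + 1) / 2 - 1) := by
  have hpos := (mem_posDefHermitian_iff.1 hW).1
  have hβ : (beta F : ℝ) ≠ 0 := Nat.cast_ne_zero.2 beta_pos.ne'
  rw [gramDensity, Set.indicator_of_mem hW,
    ENNReal.toReal_ofReal (Real.rpow_nonneg (detR_nonneg hpos) _), hermitianDet_eq_detR_rpow hpos,
    ← Real.rpow_mul (detR_nonneg hpos)]
  congr 1
  field_simp

end Density

/-! ### Lebesgue measure and radial integration -/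

section Radial

variable {F : Type*} [NormedDivisionRing F] [NormedAlgebra ℝ F]
  [ProperSpace F] [MeasureSpace F] [BorelSpace F]

/-- The measure of the scalars is Lebesgue measure: a Haar measure of the additive group, normalised
so that the Gaussian integral has the value `π ^ (β / 2)`. -/
class LebesgueVolume (F : Type*) [NormedDivisionRing F] [NormedAlgebra ℝ F] [MeasureSpace F] :
    Prop where
  isAddHaarMeasure : (volume : Measure F).IsAddHaarMeasure
  integral_gaussian : ∫ a : F, Real.exp (-‖a‖ ^ 2) = Real.pi ^ ((beta F : ℝ) / 2)

attribute [instance] LebesgueVolume.isAddHaarMeasure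

/-- Scalars that form a proper space are finite-dimensional over `ℝ`, by the theorem of Riesz. -/
theorem finiteDimensional_of_proper (F : Type*) [NormedDivisionRing F] [NormedAlgebra ℝ F]
    [ProperSpace F] : FiniteDimensional ℝ F := FiniteDimensional.of_locallyCompactSpace ℝ

/-- An injective linear map that leaves a continuous function with bounded sublevel set invariant
preserves Lebesgue measure. -/
theorem measurePreserving_of_invariant {E : Type*} [NormedAddCommGroup E] [NormedSpace ℝ E]
    [MeasurableSpace E] [BorelSpace E] [FiniteDimensional ℝ E] (μ : Measure E) [μ.IsAddHaarMeasure]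
    {L : E →ₗ[ℝ] E} (hL : Function.Injective L) {q : E → ℝ} (hq : Continuous q) (hq0 : q 0 = 0)
    (hbdd : Bornology.IsBounded {x | q x < 1}) (hinv : ∀ x, q (L x) = q x) :
    MeasurePreserving L μ μ := by
  have hLm : Measurable L := L.continuous_of_finiteDimensional.measurable
  refine ⟨hLm, ?_⟩
  have hdet : LinearMap.det L ≠ 0 := fun h =>
    (LinearMap.bot_lt_ker_of_det_eq_zero h).ne' (LinearMap.ker_eq_bot.2 hL)
  have hopen : IsOpen {x | q x < 1} := isOpen_lt hq continuous_const
  have h := Measure.map_linearMap_addHaar_eq_smul_addHaar μ hdet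
  have h1 : μ {x | q x < 1} ≠ 0 := (hopen.measure_pos μ ⟨0, by simp [hq0]⟩).ne'
  have h2 : μ {x | q x < 1} ≠ ⊤ := hbdd.measure_lt_top.ne
  have h3 := congrArg (fun ν => ν {x | q x < 1}) h
  simp only [Measure.map_apply hLm hopen.measurableSet, Set.preimage_ofPred_eq, hinv,
    Measure.smul_apply, smul_eq_mul] at h3
  have h4 : ENNReal.ofReal |(LinearMap.det L)⁻¹| = 1 :=
    ((ENNReal.mul_eq_right h1 h2).1 h3.symm)
  rw [h, h4, one_smul]

omit [NormedAlgebra ℝ F] in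
theorem measurable_normSqVec {ι : Type*} [Fintype ι] : Measurable (normSqVec : (ι → F) → ℝ) :=
  continuous_normSqVec.measurable

/-- Integration of radial functions in polar coordinates, with constant left unspecified. -/
theorem exists_lintegral_normSqVec [LebesgueVolume F] {m : ℕ} (hm : 0 < m) :
    ∃ κ : ENNReal, ∀ φ : ℝ → ENNReal, Measurable φ →
      ∫⁻ w : Fin m → F, φ (normSqVec w) =
        κ * ∫⁻ s in Set.Ioi (0 : ℝ), ENNReal.ofReal (s ^ ((beta F : ℝ) * m / 2 - 1)) * φ s := by
  have hfd := finiteDimensional_of_proper F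
  let E := PiLp 2 fun _ : Fin m => F
  let e := PiLp.continuousLinearEquiv 2 ℝ (fun _ : Fin m => F)
  let μ : Measure E := Measure.map e.symm volume
  have hμ : μ.IsAddHaarMeasure := e.symm.isAddHaarMeasure_map volume
  have hem : Measurable e.symm := e.symm.continuous.measurable
  have hdim : Module.finrank ℝ E = beta F * m := by
    rw [e.toLinearEquiv.finrank_eq, Module.finrank_pi_fintype]
    simp [beta, mul_comm]
  have hdpos : 0 < beta F * m := Nat.mul_pos Module.finrank_pos hm
  have hnt : Nontrivial E := Module.nontrivial_of_finrank_pos (R := ℝ) (hdim ▸ hdpos)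
  refine ⟨μ.toSphere Set.univ * ENNReal.ofReal 2⁻¹, fun φ hφ => ?_⟩
  have hφ' : Measurable fun x : E => φ (‖x‖ ^ 2) := hφ.comp (by fun_prop)
  -- Vectors with the Euclidean norm, so that `normSqVec` is the square of the norm.
  have step1 : ∫⁻ w : Fin m → F, φ (normSqVec w) = ∫⁻ x, φ (‖x‖ ^ 2) ∂μ := by
    rw [lintegral_map hφ' hem]
    refine lintegral_congr fun w => ?_
    rw [norm_toLp_eq_sqrt, Real.sq_sqrt (normSqVec_nonneg _)]
    rfl
  -- Polar coordinates, with radius `y`.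
  have step2 : ∫⁻ x, φ (‖x‖ ^ 2) ∂μ = μ.toSphere Set.univ *
      ∫⁻ y in Set.Ioi (0 : ℝ), ENNReal.ofReal (y ^ (beta F * m - 1)) * φ (y ^ 2) := by
    have hmeas : Measurable fun r : Set.Ioi (0 : ℝ) => φ ((r : ℝ) ^ 2) :=
      hφ.comp (by fun_prop)
    calc ∫⁻ x, φ (‖x‖ ^ 2) ∂μ = ∫⁻ x in ({0}ᶜ : Set E), φ (‖x‖ ^ 2) ∂μ := by
          rw [restrict_compl_singleton]
      _ = ∫⁻ x : ({0}ᶜ : Set E), φ (‖(x : E)‖ ^ 2) ∂(μ.comap Subtype.val) :=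
          (lintegral_subtype_comap (measurableSet_singleton _).compl fun x => φ (‖x‖ ^ 2)).symm
      _ = ∫⁻ p, φ ((p.2 : ℝ) ^ 2)
            ∂(μ.toSphere.prod (Measure.volumeIoiPow (Module.finrank ℝ E - 1))) := by
          refine Eq.trans ?_ ((μ.measurePreserving_homeomorphUnitSphereProd).lintegral_comp
            (f := fun p => φ ((p.2 : ℝ) ^ 2)) (hmeas.comp measurable_snd))
          refine lintegral_congr fun x => ?_
          simp
      _ = μ.toSphere Set.univ *
            ∫⁻ r, φ ((r : ℝ) ^ 2) ∂(Measure.volumeIoiPow (Module.finrank ℝ E - 1)) := by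
          have := lintegral_prod_mul (μ := μ.toSphere)
            (ν := Measure.volumeIoiPow (Module.finrank ℝ E - 1)) (f := fun _ => 1)
            (g := fun r => φ ((r : ℝ) ^ 2)) aemeasurable_const hmeas.aemeasurable
          simpa using this
      _ = _ := by
          rw [Measure.volumeIoiPow, lintegral_withDensity_eq_lintegral_mul _ (by fun_prop) hmeas,
            hdim]
          congr 1
          exact lintegral_subtype_comap measurableSet_Ioi
            fun y => ENNReal.ofReal (y ^ (beta F * m - 1)) * φ (y ^ 2)
  -- The substitution `s = y ^ 2`.
  have step3 : ∫⁻ s in Set.Ioi (0 : ℝ), ENNReal.ofReal (s ^ ((beta F : ℝ) * m / 2 - 1)) * φ s =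
      ∫⁻ y in Set.Ioi (0 : ℝ), ENNReal.ofReal |2 * y| *
        (ENNReal.ofReal ((y ^ 2) ^ ((beta F : ℝ) * m / 2 - 1)) * φ (y ^ 2)) := by
    have himg : (fun y : ℝ => y ^ 2) '' Set.Ioi 0 = Set.Ioi 0 := by
      ext s
      constructor
      · rintro ⟨y, hy, rfl⟩
        exact Set.mem_Ioi.2 (pow_pos (Set.mem_Ioi.1 hy) 2)
      · intro hs
        exact ⟨√s, Real.sqrt_pos.2 hs, Real.sq_sqrt (le_of_lt hs)⟩
    have hinj : Set.InjOn (fun y : ℝ => y ^ 2) (Set.Ioi 0) := fun a ha b hb h =>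
      (pow_left_inj₀ (le_of_lt ha) (le_of_lt hb) two_ne_zero).1 h
    have := lintegral_image_eq_lintegral_abs_deriv_mul measurableSet_Ioi
      (fun y _ => ((hasDerivAt_pow 2 y).hasDerivWithinAt (s := Set.Ioi 0))) hinj
      (fun s => ENNReal.ofReal (s ^ ((beta F : ℝ) * m / 2 - 1)) * φ s)
    rw [himg] at this
    simpa using this
  rw [step1, step2, step3, mul_assoc, ← lintegral_const_mul' _ _ ENNReal.ofReal_ne_top]
  congr 1
  refine setLIntegral_congr_fun measurableSet_Ioi fun y hy => ?_
  have hy : 0 < y := hy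
  rw [← mul_assoc, ← mul_assoc, ← ENNReal.ofReal_mul (by norm_num),
    ← ENNReal.ofReal_mul (by positivity)]
  congr 2
  rw [abs_of_pos (by positivity), inv_mul_cancel_left₀ two_ne_zero, ← Real.rpow_natCast y 2,
    ← Real.rpow_mul hy.le, ← Real.rpow_natCast, Nat.cast_sub (Nat.succ_le_of_lt hdpos)]
  nth_rw 2 [← Real.rpow_one y]
  rw [← Real.rpow_add hy]
  congr 1
  push_cast
  ring

omit [BorelSpace F] in
theorem integral_gaussian_vec [LebesgueVolume F] (m : ℕ) :
    ∫ w : Fin m → F, Real.exp (-normSqVec w) = Real.pi ^ ((beta F : ℝ) * m / 2) := by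
  have hfd := finiteDimensional_of_proper F
  have h := integral_fintype_prod_volume_eq_prod (𝕜 := ℝ) (ι := Fin m) (E := fun _ => F)
    fun _ a => Real.exp (-‖a‖ ^ 2)
  have e : (fun w : Fin m → F => Real.exp (-normSqVec w)) =
      fun w => ∏ i, Real.exp (-‖w i‖ ^ 2) := by
    funext w
    rw [← Real.exp_sum, Finset.sum_neg_distrib, normSqVec]
  rw [e, h, LebesgueVolume.integral_gaussian, Finset.prod_const, Finset.card_univ, Fintype.card_fin,
    ← Real.rpow_natCast, ← Real.rpow_mul Real.pi_pos.le]
  congr 1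
  ring

/-- Integration of radial functions: `dw = (σ / 2) s ^ (β m / 2 - 1) ds` with `s = |w|²`. The
constant is found by inserting a Gaussian. -/
theorem lintegral_normSqVec [LebesgueVolume F] {m : ℕ} (hm : 0 < m) {φ : ℝ → ENNReal}
    (hφ : Measurable φ) :
    ∫⁻ w : Fin m → F, φ (normSqVec w) = ENNReal.ofReal (sphereArea ((beta F : ℝ) * m) / 2) *
      ∫⁻ s in Set.Ioi (0 : ℝ), ENNReal.ofReal (s ^ ((beta F : ℝ) * m / 2 - 1)) * φ s := by
  have hfd := finiteDimensional_of_proper F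
  obtain ⟨κ, hκ⟩ := exists_lintegral_normSqVec (F := F) hm
  have hd : 0 < (beta F : ℝ) * m / 2 := by
    have : 0 < beta F := Module.finrank_pos
    positivity
  -- At `φ s = exp (-s)` the formula reads `π ^ (β m / 2) = κ Γ(β m / 2)`.
  have h1 := hκ (fun s => ENNReal.ofReal (Real.exp (-s))) (by fun_prop)
  have hG := integral_gaussian_vec (F := F) m
  have hint : Integrable fun w : Fin m → F => Real.exp (-normSqVec w) := by
    -- The integral of a non-integrable function would be the junk value `0`.
    by_contra h
    rw [integral_undef h] at hG
    exact (Real.rpow_pos_of_pos Real.pi_pos _).ne hG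
  have h2 : ∫⁻ w : Fin m → F, ENNReal.ofReal (Real.exp (-normSqVec w)) =
      ENNReal.ofReal (Real.pi ^ ((beta F : ℝ) * m / 2)) := by
    rw [← ofReal_integral_eq_lintegral_ofReal hint
      (Filter.Eventually.of_forall fun _ => (Real.exp_pos _).le), hG]
  have h3 : ∫⁻ s in Set.Ioi (0 : ℝ), ENNReal.ofReal (s ^ ((beta F : ℝ) * m / 2 - 1)) *
      ENNReal.ofReal (Real.exp (-s)) = ENNReal.ofReal (Real.Gamma ((beta F : ℝ) * m / 2)) := by
    rw [Real.Gamma_eq_integral hd,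
      ofReal_integral_eq_lintegral_ofReal (Real.GammaIntegral_convergent hd)]
    · refine setLIntegral_congr_fun measurableSet_Ioi fun s hs => ?_
      rw [mul_comm, ← ENNReal.ofReal_mul (Real.exp_pos _).le]
    · rw [Filter.EventuallyLE, ae_restrict_iff' measurableSet_Ioi]
      exact Filter.Eventually.of_forall fun s hs =>
        mul_nonneg (Real.exp_pos _).le (Real.rpow_nonneg (le_of_lt hs) _)
  rw [h2, h3] at h1
  have hΓ := Real.Gamma_pos_of_pos hd
  rw [hκ φ hφ]
  congr 1
  rw [sphereArea, mul_div_assoc 2, mul_div_cancel_left₀ _ two_ne_zero, ENNReal.ofReal_div_of_pos hΓ,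
    h1, ENNReal.mul_div_cancel_right (by simpa using hΓ) ENNReal.ofReal_ne_top]

variable [LebesgueVolume F]

/-- The change of variables `u = S y`. -/
theorem lintegral_mulVec {N : ℕ} {S : Matrix (Fin N) (Fin N) F} (hS : detR S ≠ 0)
    {H : (Fin N → F) → ENNReal} (hH : Measurable H) :
    ∫⁻ y, H (S *ᵥ y) = ENNReal.ofReal |(detR S)⁻¹| * ∫⁻ u, H u := by
  have := finiteDimensional_of_proper F
  have hm : Measurable (mulVecReal S) :=
    (mulVecReal S).continuous_of_finiteDimensional.measurable
  have h := Measure.map_linearMap_addHaar_eq_smul_addHaar (f := mulVecReal S) volume hS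
  have h1 := lintegral_map (μ := volume) hH hm
  rw [h, lintegral_smul_measure, smul_eq_mul] at h1
  exact h1.symm

omit [BorelSpace F] in
/-- Concatenation identifies `F ^ N × F ^ m` with `F ^ (N + m)` as measure spaces. -/
theorem measurePreserving_append (N m : ℕ) :
    MeasurePreserving (fun p : (Fin N → F) × (Fin m → F) => Fin.append p.1 p.2) volume volume := by
  have := finiteDimensional_of_proper F
  have h1 := (volume_measurePreserving_sumPiEquivProdPi fun _ : Fin N ⊕ Fin m => F).symm
  have h2 := volume_measurePreserving_piCongrLeft (fun _ : Fin (N + m) => F) finSumFinEquiv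
  convert h2.comp h1 using 1
  funext p
  refine funext fun i => ?_
  induction i using Fin.addCases with
  | left i =>
    have := Equiv.piCongrLeft_apply_apply (fun _ : Fin (N + m) => F) finSumFinEquiv
      ((MeasurableEquiv.sumPiEquivProdPi fun _ : Fin N ⊕ Fin m => F).symm p) (Sum.inl i)
    rw [Fin.append_left]
    exact this.symm
  | right i =>
    have := Equiv.piCongrLeft_apply_apply (fun _ : Fin (N + m) => F) finSumFinEquiv
      ((MeasurableEquiv.sumPiEquivProdPi fun _ : Fin N ⊕ Fin m => F).symm p) (Sum.inr i)
    rw [Fin.append_right]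
    exact this.symm

end Radial

/-! ### Measurability -/

section MatrixTopology

variable {F : Type*} [NormedDivisionRing F] [NormedAlgebra ℝ F] [StarRing F] [ConjNorm F]
  [ContinuousStar F] [ProperSpace F]

instance instSecondCountableTopologyMatrix {m k F : Type*} [Countable m] [Countable k]
    [TopologicalSpace F] [SecondCountableTopology F] : SecondCountableTopology (Matrix m k F) :=
  inferInstanceAs (SecondCountableTopology (m → k → F))

instance instPolishSpaceMatrix {m k F : Type*} [Countable m] [Countable k]
    [TopologicalSpace F] [PolishSpace F] : PolishSpace (Matrix m k F) :=
  inferInstanceAs (PolishSpace (m → k → F))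

theorem isClosed_posHermitian {N : ℕ} : IsClosed (posHermitian F N) := by
  have := finiteDimensional_of_proper F
  have h : posHermitian F N = {W | Wᴴ = W} ∩ ⋂ v, {W | 0 ≤ hermForm W v} := by
    ext W
    rw [mem_posHermitian_iff]
    simp [IsHermitian]
  rw [h]
  refine (isClosed_eq (continuous_id.matrix_conjTranspose) continuous_id).inter
    (isClosed_iInter fun v => isClosed_le continuous_const ?_)
  exact continuous_realPart.comp
    (continuous_const.dotProduct (continuous_id.matrix_mulVec continuous_const))

variable [MeasurableSpace F] [BorelSpace F]

theorem measurableSet_posHermitian {N : ℕ} : MeasurableSet (posHermitian F N) :=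
  isClosed_posHermitian.measurableSet

omit [StarRing F] [ConjNorm F] [ContinuousStar F] in
theorem measurable_detR {N : ℕ} : Measurable (detR : Matrix (Fin N) (Fin N) F → ℝ) :=
  continuous_detR.measurable

theorem measurableSet_posDefHermitian {N : ℕ} : MeasurableSet (posDefHermitian F N) := by
  have := finiteDimensional_of_proper F
  have h : posDefHermitian F N = posHermitian F N ∩ detR ⁻¹' {0}ᶜ := by
    ext W
    rw [mem_posDefHermitian_iff]
    simp
  rw [h]
  exact measurableSet_posHermitian.inter (measurable_detR (measurableSet_singleton _).compl)

omit [ConjNorm F] in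
theorem measurable_hermBlock {N : ℕ} :
    Measurable fun p : Matrix (Fin N) (Fin N) F × (Fin N → F) × ℝ => hermBlock p.1 p.2.1 p.2.2 := by
  refine Continuous.measurable (continuous_matrix fun i j => ?_)
  induction i using Fin.lastCases with
  | last =>
    induction j using Fin.lastCases with
    | last =>
      simp only [hermBlock, border_last_last]
      exact (continuous_algebraMap ℝ F).comp (by fun_prop)
    | cast j =>
      simp only [hermBlock, border_last_castSucc, Pi.star_apply]
      fun_prop
  | cast i =>
    induction j using Fin.lastCases with
    | last =>
      simp only [hermBlock, border_castSucc_last]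
      fun_prop
    | cast j =>
      simp only [hermBlock, border_castSucc_castSucc]
      exact continuous_fst.matrix_elem i j

omit [ConjNorm F] in
theorem measurable_hermBlock_right {N : ℕ} (W : Matrix (Fin N) (Fin N) F) :
    Measurable fun p : (Fin N → F) × ℝ => hermBlock W p.1 p.2 :=
  measurable_hermBlock.comp (measurable_const.prodMk measurable_id)

theorem measurable_gramDensity {n N : ℕ} : Measurable (gramDensity F n N) :=
  (ENNReal.measurable_ofReal.comp (measurable_detR.pow_const _)).indicator
    measurableSet_posDefHermitian

end MatrixTopology

/-! ### The Gram matrix of a matrix with one further column -/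

section LinearChanges

variable {F : Type*} [NormedDivisionRing F] [NormedAlgebra ℝ F] [StarRing F] [ConjNorm F]
  [ContinuousStar F] [ProperSpace F] [MeasureSpace F] [BorelSpace F] [LebesgueVolume F]

omit [ContinuousStar F] in
theorem measurePreserving_mulVec {n : ℕ} {k : Matrix (Fin n) (Fin n) F} (hk : kᴴ * k = 1) :
    MeasurePreserving (fun v : Fin n → F => k *ᵥ v) volume volume := by
  have := finiteDimensional_of_proper F
  refine measurePreserving_of_invariant (L := mulVecReal k) volume (fun v w h => ?_)
    continuous_normSqVec (normSqVec_eq_zero.2 rfl) isBounded_normSqVec_lt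
    (normSqVec_mulVec_of_isometry hk)
  have h' : k *ᵥ v = k *ᵥ w := h
  rw [← one_mulVec v, ← one_mulVec w, ← hk, ← mulVec_mulVec, h', mulVec_mulVec]

omit [ContinuousStar F] in
/-- Lebesgue measure on matrices is invariant under multiplication by unitary matrices. -/
theorem measurePreserving_mul_left {n N : ℕ} {k : Matrix (Fin n) (Fin n) F} (hk : kᴴ * k = 1) :
    MeasurePreserving (fun M : Matrix (Fin n) (Fin N) F => k * M) (matrixMeasure F n N)
      (matrixMeasure F n N) := by
  have := finiteDimensional_of_proper F
  let q : (Fin n → Fin N → F) → ℝ := fun M => ∑ i, normSqVec (M i)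
  have hq : ∀ M : Fin n → Fin N → F, q M = ∑ j, normSqVec fun i => M i j := fun M =>
    Finset.sum_comm
  let L : (Fin n → Fin N → F) →ₗ[ℝ] (Fin n → Fin N → F) :=
    { toFun := fun M => k * (of M : Matrix (Fin n) (Fin N) F)
      map_add' := fun M M' => Matrix.mul_add k M M'
      map_smul' := fun c M => Matrix.mul_smul k c M }
  have hμ : (Measure.pi fun _ : Fin n => (volume : Measure (Fin N → F))).IsAddHaarMeasure :=
    Measure.pi.isAddHaarMeasure _
  refine measurePreserving_of_invariant (E := Fin n → Fin N → F) (L := L)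
    (Measure.pi fun _ => volume) (fun M M' h => ?_) (q := q)
    (continuous_finsetSum _ fun i _ => continuous_normSqVec.comp (continuous_apply i))
    (Finset.sum_eq_zero fun i _ => normSqVec_eq_zero.2 rfl) ?_ (fun M => ?_)
  · have h' : k * (of M : Matrix (Fin n) (Fin N) F) = k * of M' := h
    have := congrArg (fun X => kᴴ * X) h'
    simpa only [← Matrix.mul_assoc, hk, Matrix.one_mul, EmbeddingLike.apply_eq_iff_eq] using this
  · refine (Metric.isBounded_closedBall (x := (0 : Fin n → Fin N → F)) (r := 1)).subset
      fun M hM => ?_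
    rw [mem_closedBall_zero_iff, pi_norm_le_iff_of_nonneg zero_le_one]
    intro i
    rw [pi_norm_le_iff_of_nonneg zero_le_one]
    intro j
    have h1 : ‖M i j‖ ^ 2 ≤ normSqVec (M i) :=
      Finset.single_le_sum (f := fun j => ‖M i j‖ ^ 2) (fun _ _ => sq_nonneg _) (Finset.mem_univ j)
    have h2 : normSqVec (M i) ≤ q M :=
      Finset.single_le_sum (f := fun i => normSqVec (M i)) (fun _ _ => normSqVec_nonneg _)
        (Finset.mem_univ i)
    have h' : q M < 1 := hM
    nlinarith [norm_nonneg (M i j)]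
  · rw [hq, hq]
    exact Finset.sum_congr rfl fun j _ => normSqVec_mulVec_of_isometry hk fun i => M i j

omit [ContinuousStar F] in
/-- Rotating `v` into `(y, w)`, where `M = U S` is the polar decomposition and the columns of `U`
become the first `N` coordinate vectors. -/
theorem lintegral_conjTranspose_mulVec {N m : ℕ} (M : Matrix (Fin (N + m)) (Fin N) F)
    {φ : (Fin N → F) × ℝ → ENNReal} (hφ : Measurable φ) :
    ∫⁻ v, φ (Mᴴ *ᵥ v, normSqVec v) = ∫⁻ y : Fin N → F, ∫⁻ w : Fin m → F,
      φ (hermitianSqrt (Mᴴ * M) *ᵥ y, normSqVec y + normSqVec w) := by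
  have := finiteDimensional_of_proper F
  obtain ⟨U, hU⟩ := exists_polar (Nat.le_add_right N m) M
  obtain ⟨k, hk⟩ := exists_firstColumns_eq (Nat.le_add_right N m) U
  have hS := hermitianSqrt_mem (conjTranspose_mul_self_mem_posHermitian M)
  have hk1 : (k : Matrix (Fin (N + m)) (Fin (N + m)) F)ᴴ * k = 1 := (Unitary.mem_iff.1 k.2).1
  have hUk : ∀ (y : Fin N → F) (w : Fin m → F),
      Mᴴ *ᵥ ((k : Matrix (Fin (N + m)) (Fin (N + m)) F) *ᵥ Fin.append y w) =
        hermitianSqrt (Mᴴ * M) *ᵥ y := by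
    intro y w
    have e : Mᴴ = hermitianSqrt (Mᴴ * M) * (U : Matrix (Fin (N + m)) (Fin N) F)ᴴ := by
      conv_lhs => rw [hU, conjTranspose_mul, hS.1.eq]
    conv_lhs => rw [e]
    rw [← mulVec_mulVec, ← hk, mulVec_mulVec _ _ (k : Matrix (Fin (N + m)) (Fin (N + m)) F),
      conjTranspose_firstColumns_mul]
    congr 1
    funext i
    simp [mulVec, dotProduct, Fin.sum_univ_add, Pi.single_apply]
  have m1 : Measurable fun v : Fin (N + m) → F => φ (Mᴴ *ᵥ v, normSqVec v) :=
    hφ.comp (Measurable.prodMk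
      (continuous_const.matrix_mulVec continuous_id).measurable measurable_normSqVec)
  have m2 : Measurable fun v : Fin (N + m) → F =>
      φ (Mᴴ *ᵥ ((k : Matrix (Fin (N + m)) (Fin (N + m)) F) *ᵥ v), normSqVec v) :=
    hφ.comp (Measurable.prodMk (continuous_const.matrix_mulVec
      (continuous_const.matrix_mulVec continuous_id)).measurable measurable_normSqVec)
  rw [← (measurePreserving_mulVec hk1).lintegral_comp m1]
  simp only [normSqVec_mulVec_of_isometry hk1]
  rw [← (measurePreserving_append N m).lintegral_comp m2]
  simp only [hUk, normSqVec_append]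
  refine lintegral_prod _ (Measurable.aemeasurable (hφ.comp (Measurable.prodMk ?_ ?_)))
  · exact (continuous_const.matrix_mulVec continuous_fst).measurable
  · exact (measurable_normSqVec.comp measurable_fst).add
      (measurable_normSqVec.comp measurable_snd)

omit [ContinuousStar F] [MeasureSpace F] [BorelSpace F] [LebesgueVolume F] in
/-- Integration over a Schur complement `s > 0` with weight `s ^ (β m / 2 - 1)` amounts to
integration over the corner entry `t = |y|² + s` with the density of the Gram matrix. -/
theorem lintegral_schur {N m : ℕ} {S : Matrix (Fin N) (Fin N) F} (hS : S ∈ posHermitian F N)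
    (hdet : detR S ≠ 0) {f : Matrix (Fin (N + 1)) (Fin (N + 1)) F → ENNReal}
    (y : Fin N → F) :
    ∫⁻ s in Set.Ioi (0 : ℝ), ENNReal.ofReal (s ^ ((beta F : ℝ) * m / 2 - 1)) *
        f (hermBlock (S * S) (S *ᵥ y) (normSqVec y + s)) =
      ENNReal.ofReal (detR (S * S) ^ (-((m : ℝ) / 2 - 1 / (beta F : ℝ)))) *
        ∫⁻ t, gramDensity F (N + m) (N + 1) (hermBlock (S * S) (S *ᵥ y) t) *
          f (hermBlock (S * S) (S *ᵥ y) t) := by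
  have := finiteDimensional_of_proper F
  have hpos : 0 < detR (S * S) := by
    rw [detR_mul]; exact mul_self_pos.2 hdet
  rw [← lintegral_add_left_eq_self (μ := volume)
      (fun t => gramDensity F (N + m) (N + 1) (hermBlock (S * S) (S *ᵥ y) t) *
        f (hermBlock (S * S) (S *ᵥ y) t)) (normSqVec y),
    ← lintegral_const_mul' _ _ ENNReal.ofReal_ne_top, ← lintegral_indicator measurableSet_Ioi]
  refine lintegral_congr fun s => ?_
  rw [gramDensity_hermBlock hS hdet, ← mul_assoc, ← mul_assoc,
    ← ENNReal.ofReal_mul (Real.rpow_nonneg hpos.le _), ← Real.rpow_add hpos, neg_add_cancel,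
    Real.rpow_zero, ENNReal.ofReal_one, one_mul]
  by_cases hs : s ∈ Set.Ioi (0 : ℝ)
  · rw [Set.indicator_of_mem hs, Set.indicator_of_mem hs]
  · rw [Set.indicator_of_notMem hs, Set.indicator_of_notMem hs, zero_mul]

/-- The contribution of a further column `v` to the Gram matrix of `M`, for fixed `M` of full
rank. -/
theorem lintegral_appendCol {N m : ℕ} (hm : 0 < m) {M : Matrix (Fin (N + m)) (Fin N) F}
    (hM : Mᴴ * M ∈ posDefHermitian F N) {f : Matrix (Fin (N + 1)) (Fin (N + 1)) F → ENNReal}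
    (hf : Measurable f) :
    ∫⁻ v, f ((appendCol M v)ᴴ * appendCol M v) =
      ENNReal.ofReal (sphereArea ((beta F : ℝ) * m) / 2) *
        (ENNReal.ofReal (detR (Mᴴ * M) ^ (-(1 / 2 : ℝ) - ((m : ℝ) / 2 - 1 / (beta F : ℝ)))) *
          ∫⁻ u, ∫⁻ t, gramDensity F (N + m) (N + 1) (hermBlock (Mᴴ * M) u t) *
            f (hermBlock (Mᴴ * M) u t)) := by
  have := finiteDimensional_of_proper F
  obtain ⟨hpos, hdetW⟩ := mem_posDefHermitian_iff.1 hM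
  have hfm : Measurable fun p : (Fin N → F) × ℝ => f (hermBlock (Mᴴ * M) p.1 p.2) :=
    hf.comp (measurable_hermBlock_right _)
  have h1 := lintegral_conjTranspose_mulVec M hfm
  simp only [← appendCol_gram] at h1
  rw [h1]
  have hS := hermitianSqrt_mem hpos
  have hSS := hermitianSqrt_mul_self hpos
  set W := Mᴴ * M
  set S := hermitianSqrt W
  have hW0 : 0 < detR W := (detR_nonneg hpos).lt_of_ne hdetW.symm
  have hdet2 : detR S * detR S = detR W := by rw [← detR_mul, hSS]
  have hdet : detR S ≠ 0 := fun h => hdetW (by rw [← hdet2, h, mul_zero])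
  have h2 : ∀ y : Fin N → F,
      ∫⁻ w : Fin m → F, f (hermBlock W (S *ᵥ y) (normSqVec y + normSqVec w)) =
      ENNReal.ofReal (sphereArea ((beta F : ℝ) * m) / 2) *
        (ENNReal.ofReal (detR W ^ (-((m : ℝ) / 2 - 1 / (beta F : ℝ)))) *
          ∫⁻ t, gramDensity F (N + m) (N + 1) (hermBlock W (S *ᵥ y) t) *
            f (hermBlock W (S *ᵥ y) t)) := fun y => by
    have h3 := lintegral_schur (m := m) (f := f) hS hdet y
    rw [hSS] at h3
    rw [← h3]
    exact lintegral_normSqVec hm (φ := fun s => f (hermBlock W (S *ᵥ y) (normSqVec y + s)))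
      (hfm.comp (measurable_const.prodMk (measurable_const.add measurable_id)))
  have hg : Measurable fun p : (Fin N → F) × ℝ =>
      gramDensity F (N + m) (N + 1) (hermBlock W p.1 p.2) * f (hermBlock W p.1 p.2) :=
    (measurable_gramDensity.comp (measurable_hermBlock_right _)).mul hfm
  have hH : Measurable fun u : Fin N → F => ∫⁻ t, gramDensity F (N + m) (N + 1) (hermBlock W u t) *
      f (hermBlock W u t) := hg.lintegral_prod_right'
  simp only [h2]
  rw [lintegral_const_mul' _ _ ENNReal.ofReal_ne_top,
    lintegral_const_mul' _ _ ENNReal.ofReal_ne_top, lintegral_mulVec hdet hH, ← mul_assoc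
    (ENNReal.ofReal (detR W ^ _)), ← ENNReal.ofReal_mul (Real.rpow_nonneg hW0.le _)]
  -- The Jacobian of `u = S y`, as a power of `detR W = (detR S) ^ 2`.
  have hsq : |(detR S)⁻¹| = detR W ^ (-(1 / 2 : ℝ)) := by
    rw [Real.rpow_neg hW0.le, ← Real.sqrt_eq_rpow, ← hdet2, Real.sqrt_mul_self_eq_abs, abs_inv]
  rw [hsq, ← Real.rpow_add hW0, add_comm, ← sub_eq_add_neg]

end LinearChanges

/-! ### Splitting off the last column -/

section Splitting

/-- Appending a last coordinate identifies `X ^ N × X` with `X ^ (N + 1)` as measure spaces. -/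
theorem measurePreserving_snoc {X : Type*} [MeasureSpace X] [SigmaFinite (volume : Measure X)]
    (N : ℕ) :
    MeasurePreserving (fun p : (Fin N → X) × X => (Fin.snoc p.1 p.2 : Fin (N + 1) → X))
      volume volume := by
  have h := (volume_preserving_piFinSuccAbove (fun _ : Fin (N + 1) => X) (Fin.last N)).symm.comp
    (Measure.measurePreserving_swap (μ := (volume : Measure (Fin N → X)))
      (ν := (volume : Measure X)))
  have e : (fun p : (Fin N → X) × X => (Fin.snoc p.1 p.2 : Fin (N + 1) → X)) =
      (MeasurableEquiv.piFinSuccAbove (fun _ : Fin (N + 1) => X) (Fin.last N)).symm ∘ Prod.swap :=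
    funext fun p => (Fin.insertNth_last' p.2 p.1).symm
  rw [e]
  exact h

theorem measurePreserving_prodProdProdComm {A B C D : Type*} [MeasureSpace A] [MeasureSpace B]
    [MeasureSpace C] [MeasureSpace D] [SFinite (volume : Measure A)]
    [SFinite (volume : Measure B)] [SFinite (volume : Measure C)]
    [SFinite (volume : Measure D)] :
    MeasurePreserving (fun p : (A × B) × (C × D) => ((p.1.1, p.2.1), (p.1.2, p.2.2)))
      volume volume := by
  have s1 := volume_preserving_prodAssoc (α₁ := A) (β₁ := B) (γ₁ := C × D)
  have s2 := (volume_preserving_prodAssoc (α₁ := B) (β₁ := C) (γ₁ := D)).symm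
  have s3 := (Measure.measurePreserving_swap (μ := (volume : Measure B))
      (ν := (volume : Measure C))).prod (MeasurePreserving.id (volume : Measure D))
  have s4 := volume_preserving_prodAssoc (α₁ := C) (β₁ := B) (γ₁ := D)
  have s5 := (volume_preserving_prodAssoc (α₁ := A) (β₁ := C) (γ₁ := B × D)).symm
  exact s5.comp (((MeasurePreserving.id (volume : Measure A)).prod (s4.comp (s3.comp s2))).comp s1)

variable {F : Type*} [NormedDivisionRing F] [NormedAlgebra ℝ F] [StarRing F] [ConjNorm F]
  [ContinuousStar F] [ProperSpace F] [MeasureSpace F] [BorelSpace F] [LebesgueVolume F]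

instance instSigmaFiniteMatrixMeasure (n N : ℕ) : SigmaFinite (matrixMeasure F n N) := by
  have := finiteDimensional_of_proper F
  exact inferInstanceAs (SigmaFinite (Measure.pi fun _ : Fin n =>
    Measure.pi fun _ : Fin N => (volume : Measure F)))

omit [StarRing F] [ConjNorm F] [ContinuousStar F] [BorelSpace F] in
theorem measurePreserving_appendCol (n N : ℕ) :
    MeasurePreserving (fun p : Matrix (Fin n) (Fin N) F × (Fin n → F) => appendCol p.1 p.2)
      ((matrixMeasure F n N).prod volume) (matrixMeasure F n (N + 1)) := by
  have := finiteDimensional_of_proper F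
  have h1 := (volume_measurePreserving_arrowProdEquivProdArrow (Fin N → F) F (Fin n)).symm
  have h2 := volume_preserving_pi fun _ : Fin n => measurePreserving_snoc (X := F) N
  exact h2.comp h1

omit [StarRing F] [ConjNorm F] [ContinuousStar F] [BorelSpace F] in
/-- Integration over an `n × (N + 1)` matrix, with the last column innermost. -/
theorem lintegral_matrixMeasure_succ {n N : ℕ} {G : Matrix (Fin n) (Fin (N + 1)) F → ENNReal}
    (hG : Measurable G) :
    ∫⁻ M, G M ∂(matrixMeasure F n (N + 1)) =
      ∫⁻ M, (∫⁻ v, G (appendCol M v)) ∂(matrixMeasure F n N) := by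
  have := finiteDimensional_of_proper F
  have h := measurePreserving_appendCol (F := F) n N
  rw [← h.lintegral_comp hG]
  exact lintegral_prod _ (hG.comp h.measurable).aemeasurable

/-- The pairs `i < j` in `{0, …, N}` are the pairs in `{0, …, N - 1}` together with the pairs
`(i, N)`. -/
def upperPairsEquiv (N : ℕ) : {p : Fin N × Fin N // p.1 < p.2} ⊕ Fin N ≃
    {p : Fin (N + 1) × Fin (N + 1) // p.1 < p.2} :=
  Equiv.ofBijective
    (Sum.elim (fun p => ⟨(p.1.1.castSucc, p.1.2.castSucc), Fin.castSucc_lt_castSucc_iff.2 p.2⟩)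
      fun i => ⟨(i.castSucc, Fin.last N), Fin.castSucc_lt_last i⟩) (by
    constructor
    · rintro (⟨⟨i, j⟩, hij⟩ | i) (⟨⟨i', j'⟩, hij'⟩ | i') h
      · simp only [Sum.elim_inl, Subtype.mk.injEq, Prod.mk.injEq, Fin.castSucc_inj] at h
        simp [h.1, h.2]
      · simp [Fin.castSucc_ne_last] at h
      · simp [(Fin.castSucc_ne_last _).symm] at h
      · simpa using h
    · rintro ⟨⟨i, j⟩, hij⟩
      have hi : i ≠ Fin.last N := fun h => by
        subst h
        exact absurd hij (not_lt.2 (Fin.le_last j))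
      obtain ⟨i, rfl⟩ := Fin.exists_castSucc_eq.2 hi
      induction j using Fin.lastCases with
      | last => exact ⟨Sum.inr i, rfl⟩
      | cast j => exact ⟨Sum.inl ⟨(i, j), Fin.castSucc_lt_castSucc_iff.1 hij⟩, rfl⟩)

/-- The entries of `[W u; u† t]` from those of `W`, `u` and `t`. -/
def appendEntries {N : ℕ} (p : HermitianEntries F N × ((Fin N → F) × ℝ)) :
    HermitianEntries F (N + 1) :=
  (Fin.snoc p.1.1 p.2.2, fun q => Sum.elim p.1.2 p.2.1 ((upperPairsEquiv N).symm q))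

omit [ConjNorm F] [ContinuousStar F] [ProperSpace F] [MeasureSpace F] [BorelSpace F]
  [LebesgueVolume F] in
theorem hermitianOfEntries_appendEntries {N : ℕ} (c : HermitianEntries F N) (u : Fin N → F)
    (t : ℝ) : hermitianOfEntries (appendEntries (c, u, t)) =
      hermBlock (hermitianOfEntries c) u t := by
  have h1 : ∀ (i j : Fin N) (h : i.castSucc < j.castSucc),
      (appendEntries (c, u, t)).2 ⟨(i.castSucc, j.castSucc), h⟩ =
        c.2 ⟨(i, j), Fin.castSucc_lt_castSucc_iff.1 h⟩ := fun i j h => by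
    have e : (upperPairsEquiv N).symm ⟨(i.castSucc, j.castSucc), h⟩ =
        Sum.inl ⟨(i, j), Fin.castSucc_lt_castSucc_iff.1 h⟩ :=
      (Equiv.symm_apply_eq _).2 rfl
    simp [appendEntries, e]
  have h2 : ∀ (i : Fin N) (h : i.castSucc < Fin.last N),
      (appendEntries (c, u, t)).2 ⟨(i.castSucc, Fin.last N), h⟩ = u i := fun i h => by
    have e : (upperPairsEquiv N).symm ⟨(i.castSucc, Fin.last N), h⟩ = Sum.inr i :=
      (Equiv.symm_apply_eq _).2 rfl
    simp [appendEntries, e]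
  rw [hermBlock, eq_border_iff]
  refine ⟨fun i j => ?_, fun i => ?_, fun j => ?_, ?_⟩
  · simp only [hermitianOfEntries, Fin.castSucc_lt_castSucc_iff, h1]
    simp [appendEntries]
  · simp only [hermitianOfEntries, Fin.castSucc_lt_last, dif_pos, h2]
  · simp only [hermitianOfEntries, Fin.castSucc_lt_last, (Fin.castSucc_lt_last j).not_gt, dif_pos,
      dif_neg, not_false_eq_true, h2, Pi.star_apply]
  · simp [hermitianOfEntries, appendEntries]

omit [StarRing F] [ConjNorm F] [ContinuousStar F] [BorelSpace F] in
theorem measurePreserving_appendEntries (N : ℕ) :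
    MeasurePreserving (appendEntries (F := F) (N := N)) volume volume := by
  have := finiteDimensional_of_proper F
  have h1 := (volume_measurePreserving_sumPiEquivProdPi
    fun _ : {p : Fin N × Fin N // p.1 < p.2} ⊕ Fin N => F).symm
  have h2 := volume_measurePreserving_piCongrLeft
    (fun _ : {p : Fin (N + 1) × Fin (N + 1) // p.1 < p.2} => F) (upperPairsEquiv N)
  have h3 := (measurePreserving_snoc (X := ℝ) N).prod (h2.comp h1)
  have h4 := (MeasurePreserving.id (volume : Measure (HermitianEntries F N))).prod
    (Measure.measurePreserving_swap (μ := (volume : Measure (Fin N → F)))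
      (ν := (volume : Measure ℝ)))
  refine Eq.mp (congrArg (fun φ => MeasurePreserving φ volume volume) ?_)
    ((h3.comp measurePreserving_prodProdProdComm).comp h4)
  funext p
  symm
  refine Prod.ext rfl (funext fun q => ?_)
  obtain ⟨r, rfl⟩ := (upperPairsEquiv N).surjective q
  refine Eq.trans ?_ (Equiv.piCongrLeft_apply_apply
    (fun _ : {p : Fin (N + 1) × Fin (N + 1) // p.1 < p.2} => F) (upperPairsEquiv N) _ r).symm
  simp only [appendEntries, Equiv.symm_apply_apply]
  cases r <;> rfl

omit [ConjNorm F] [LebesgueVolume F] in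
theorem measurable_hermitianOfEntries {N : ℕ} :
    Measurable (hermitianOfEntries : HermitianEntries F N → Matrix (Fin N) (Fin N) F) := by
  refine Continuous.measurable (continuous_matrix fun i j => ?_)
  unfold hermitianOfEntries
  by_cases hij : i < j
  · simp only [hij, dif_pos]
    fun_prop
  · by_cases hji : j < i
    · simp only [hij, hji, dif_pos, dif_neg, not_false_eq_true]
      fun_prop
    · simp only [hij, hji, dif_neg, not_false_eq_true]
      exact (continuous_algebraMap ℝ F).comp (by fun_prop)

instance instSFiniteHermitianMeasure (N : ℕ) : SFinite (hermitianMeasure F N) := by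
  have := finiteDimensional_of_proper F
  unfold hermitianMeasure
  infer_instance

omit [ConjNorm F] in
/-- Integration over a Hermitian matrix, with the entries of the last column innermost. -/
theorem lintegral_hermitianMeasure_succ {N : ℕ}
    {G : Matrix (Fin (N + 1)) (Fin (N + 1)) F → ENNReal} (hG : Measurable G) :
    ∫⁻ W, G W ∂(hermitianMeasure F (N + 1)) =
      ∫⁻ W, (∫⁻ u, ∫⁻ t, G (hermBlock W u t)) ∂(hermitianMeasure F N) := by
  have := finiteDimensional_of_proper F
  have hb : Measurable fun p : Matrix (Fin N) (Fin N) F × ((Fin N → F) × ℝ) =>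
      G (hermBlock p.1 p.2.1 p.2.2) := hG.comp measurable_hermBlock
  have h2 : Measurable fun W : Matrix (Fin N) (Fin N) F =>
      ∫⁻ q : (Fin N → F) × ℝ, G (hermBlock W q.1 q.2) := hb.lintegral_prod_right'
  have h3 : ∀ W : Matrix (Fin N) (Fin N) F, ∫⁻ u, ∫⁻ t, G (hermBlock W u t) =
      ∫⁻ q : (Fin N → F) × ℝ, G (hermBlock W q.1 q.2) := fun W =>
    (lintegral_prod _ (hG.comp (measurable_hermBlock_right W)).aemeasurable).symm
  simp only [h3]
  rw [hermitianMeasure, hermitianMeasure, lintegral_map hG measurable_hermitianOfEntries,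
    lintegral_map h2 measurable_hermitianOfEntries,
    ← (measurePreserving_appendEntries (F := F) N).lintegral_comp
      (f := fun c => G (hermitianOfEntries c)) (hG.comp measurable_hermitianOfEntries)]
  refine Eq.trans (lintegral_prod _ ?_) ?_
  · exact ((hG.comp measurable_hermitianOfEntries).comp
      (measurePreserving_appendEntries N).measurable).aemeasurable
  · exact lintegral_congr fun c => lintegral_congr fun q =>
      congrArg G (hermitianOfEntries_appendEntries c q.1 q.2)

end Splitting

/-! ### The law of the Gram matrix -/

section Gram

variable {F : Type*} [NormedDivisionRing F] [NormedAlgebra ℝ F] [StarRing F] [ConjNorm F]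
  [ContinuousStar F] [ProperSpace F] [MeasureSpace F] [BorelSpace F] [LebesgueVolume F]

/-- Singular positive semidefinite matrices form a null set: for positive definite `W`, the
bordered matrix `[W u; u† t]` is semidefinite and singular for only one `t`. -/
theorem hermitianMeasure_singular (N : ℕ) :
    hermitianMeasure F N (posHermitian F N \ posDefHermitian F N) = 0 := by
  have := finiteDimensional_of_proper F
  have hms : ∀ N, MeasurableSet (posHermitian F N \ posDefHermitian F N) := fun N =>
    measurableSet_posHermitian.diff measurableSet_posDefHermitian
  induction N with
  | zero =>
    have : posHermitian F 0 \ posDefHermitian F 0 = ∅ := by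
      rw [Set.sdiff_eq_empty]
      exact fun W hW => ⟨hW.1, fun v hv => absurd (Subsingleton.elim v 0) hv⟩
    rw [this, measure_empty]
  | succ N ih =>
    rw [← lintegral_indicator_one (hms _),
      lintegral_hermitianMeasure_succ (measurable_one.indicator (hms _))]
    refine lintegral_eq_zero_of_ae_eq_zero ?_
    have hae : ∀ᵐ W ∂(hermitianMeasure F N), W ∉ posHermitian F N \ posDefHermitian F N :=
      measure_eq_zero_iff_ae_notMem.1 ih
    filter_upwards [hae] with W hW
    refine (lintegral_congr fun u => ?_).trans lintegral_zero
    by_cases hpos : W ∈ posHermitian F N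
    · have hpd : W ∈ posDefHermitian F N := by
        by_contra h
        exact hW ⟨hpos, h⟩
      have hdetW := (mem_posDefHermitian_iff.1 hpd).2
      have hS := hermitianSqrt_mem hpos
      have hSS := hermitianSqrt_mul_self hpos
      set S := hermitianSqrt W
      have hdet : detR S ≠ 0 := fun h => hdetW (by rw [← hSS, detR_mul, h, mul_zero])
      obtain ⟨x, hx⟩ : ∃ x, S *ᵥ x = u := (LinearMap.equivOfDetNeZero _ hdet).surjective u
      refine lintegral_eq_zero_of_ae_eq_zero ?_
      filter_upwards [measure_eq_zero_iff_ae_notMem.1 (measure_singleton (normSqVec x))] with t ht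
      refine Set.indicator_of_notMem (fun h => ht ?_) _
      have e : hermBlock W u t = hermBlock (S * S) (S *ᵥ x) (normSqVec x + (t - normSqVec x)) := by
        rw [hSS, hx, add_sub_cancel]
      rw [e, Set.mem_sdiff, hermBlock_mem_posHermitian_iff hS hdet,
        hermBlock_mem_posDefHermitian_iff hS hdet] at h
      exact sub_eq_zero.1 (le_antisymm (not_lt.1 h.2) h.1)
    · refine (lintegral_congr fun t => ?_).trans lintegral_zero
      exact Set.indicator_of_notMem (fun h => hpos (mem_posHermitian_of_hermBlock h.1)) _

theorem sphereArea_pos {l : ℝ} (hl : 0 < l) : 0 < sphereArea l := by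
  have := Real.Gamma_pos_of_pos (half_pos hl)
  have := Real.pi_pos
  unfold sphereArea
  positivity

theorem stiefelMass_succ (F : Type*) [NormedDivisionRing F] [NormedAlgebra ℝ F] (N m : ℕ) :
    stiefelMass F (N + m) (N + 1) =
      stiefelMass F (N + m) N * sphereArea ((beta F : ℝ) * m) := by
  rw [stiefelMass, Finset.prod_Icc_succ_top (by omega), stiefelMass]
  congr 3
  push_cast
  ring

/-- The distribution of the Gram matrix `M† M`, by induction on the number of columns. -/
theorem lintegral_gram {n N : ℕ} (h : N ≤ n) {f : Matrix (Fin N) (Fin N) F → ENNReal}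
    (hf : Measurable f) :
    ∫⁻ M, f (Mᴴ * M) ∂(matrixMeasure F n N) = ENNReal.ofReal (stiefelMass F n N / 2 ^ N) *
      ∫⁻ W, gramDensity F n N W * f W ∂(hermitianMeasure F N) := by
  have := finiteDimensional_of_proper F
  induction N with
  | zero =>
    have h1 : matrixMeasure F n 0 Set.univ = 1 := by
      change (Measure.pi fun _ : Fin n => Measure.pi fun _ : Fin 0 => (volume : Measure F))
        Set.univ = 1
      simp [Measure.pi_univ]
    have h2 : hermitianMeasure F 0 Set.univ = 1 := by
      rw [hermitianMeasure, Measure.map_apply measurable_hermitianOfEntries MeasurableSet.univ,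
        Set.preimage_univ, ← Set.univ_prod_univ, Measure.volume_eq_prod, Measure.prod_prod,
        volume_pi, volume_pi, Measure.pi_univ, Measure.pi_univ]
      simp
    have h3 : ∀ W : Matrix (Fin 0) (Fin 0) F, gramDensity F n 0 W = 1 := fun W => by
      have hW : W ∈ posDefHermitian F 0 :=
        ⟨Subsingleton.elim _ _, fun v hv => absurd (Subsingleton.elim v 0) hv⟩
      rw [gramDensity, Set.indicator_of_mem hW, Subsingleton.elim W 1, detR_one, Real.one_rpow,
        ENNReal.ofReal_one]
    have h4 : ∀ W : Matrix (Fin 0) (Fin 0) F, f W = f 1 := fun W => by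
      rw [Subsingleton.elim W 1]
    simp only [h3, h4, one_mul]
    simp [h1, h2, stiefelMass]
  | succ N ih =>
    obtain ⟨m, rfl⟩ := Nat.exists_eq_add_of_le (Nat.le_of_succ_le h)
    have hm : 0 < m := by omega
    have hgram : ∀ k, Measurable fun M : Matrix (Fin (N + m)) (Fin k) F => Mᴴ * M := fun k =>
      (continuous_id.matrix_conjTranspose.matrix_mul continuous_id).measurable
    -- Almost every `M` has full rank, by the induction hypothesis.
    have hae : ∀ᵐ M ∂(matrixMeasure F (N + m) N), Mᴴ * M ∈ posDefHermitian F N := by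
      have h1 := ih (Nat.le_add_right N m)
        (f := (posDefHermitian F N)ᶜ.indicator 1)
        (measurable_one.indicator measurableSet_posDefHermitian.compl)
      have h2 : ∀ W, gramDensity F (N + m) N W * (posDefHermitian F N)ᶜ.indicator 1 W = 0 := by
        intro W
        by_cases hW : W ∈ posDefHermitian F N
        · rw [Set.indicator_of_notMem (Set.notMem_compl_iff.2 hW), mul_zero]
        · rw [gramDensity, Set.indicator_of_notMem hW, zero_mul]
      simp only [h2, lintegral_zero, mul_zero] at h1
      have h3 := (lintegral_eq_zero_iff ((measurable_one.indicator
        measurableSet_posDefHermitian.compl).comp (hgram N))).1 h1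
      filter_upwards [h3] with M hM
      by_contra hc
      simp [Set.indicator_of_mem (Set.mem_compl hc)] at hM
    let g : Matrix (Fin (N + 1)) (Fin (N + 1)) F → ENNReal := fun W =>
      gramDensity F (N + m) (N + 1) W * f W
    have hg : Measurable g := measurable_gramDensity.mul hf
    have hI : Measurable fun W : Matrix (Fin N) (Fin N) F => ∫⁻ u, ∫⁻ t, g (hermBlock W u t) := by
      have hb : Measurable fun p : Matrix (Fin N) (Fin N) F × ((Fin N → F) × ℝ) =>
        g (hermBlock p.1 p.2.1 p.2.2) := hg.comp measurable_hermBlock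
      have h2 : Measurable fun W : Matrix (Fin N) (Fin N) F =>
        ∫⁻ q : (Fin N → F) × ℝ, g (hermBlock W q.1 q.2) := hb.lintegral_prod_right'
      convert h2 using 2 with W
      exact (lintegral_prod _ (hg.comp (measurable_hermBlock_right W)).aemeasurable).symm
    -- The integral over the last column, as a function of the Gram matrix of the other columns.
    let K : Matrix (Fin N) (Fin N) F → ENNReal := fun W =>
      ENNReal.ofReal (sphereArea ((beta F : ℝ) * m) / 2) *
        (ENNReal.ofReal (detR W ^ (-(1 / 2 : ℝ) - ((m : ℝ) / 2 - 1 / (beta F : ℝ)))) *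
          ∫⁻ u, ∫⁻ t, g (hermBlock W u t))
    have hK : Measurable K :=
      ((ENNReal.measurable_ofReal.comp (measurable_detR.pow_const _)).mul hI).const_mul _
    have hc : 0 ≤ sphereArea ((beta F : ℝ) * m) / 2 := by
      have : 0 < beta F := beta_pos
      exact (half_pos (sphereArea_pos (by positivity))).le
    calc ∫⁻ M, f (Mᴴ * M) ∂(matrixMeasure F (N + m) (N + 1))
        = ∫⁻ M, (∫⁻ v, f ((appendCol M v)ᴴ * appendCol M v)) ∂(matrixMeasure F (N + m) N) :=
          lintegral_matrixMeasure_succ (hf.comp (hgram (N + 1)))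
      _ = ∫⁻ M, K (Mᴴ * M) ∂(matrixMeasure F (N + m) N) := by
          refine lintegral_congr_ae ?_
          filter_upwards [hae] with M hM
          exact lintegral_appendCol hm hM hf
      _ = ENNReal.ofReal (stiefelMass F (N + m) N / 2 ^ N) *
            ∫⁻ W, gramDensity F (N + m) N W * K W ∂(hermitianMeasure F N) :=
          ih (Nat.le_add_right N m) hK
      _ = ENNReal.ofReal (stiefelMass F (N + m) N / 2 ^ N) *
            ∫⁻ W, (ENNReal.ofReal (sphereArea ((beta F : ℝ) * m) / 2) *
              ∫⁻ u, ∫⁻ t, g (hermBlock W u t)) ∂(hermitianMeasure F N) := by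
          congr 1
          refine lintegral_congr fun W => ?_
          by_cases hW : W ∈ posDefHermitian F N
          · simp only [K]
            rw [mul_left_comm, ← mul_assoc (gramDensity F (N + m) N W), gramDensity_mul_rpow hW,
              one_mul]
          · have h0 : ∀ u t, g (hermBlock W u t) = 0 := fun u t => by
              simp only [g, gramDensity]
              rw [Set.indicator_of_notMem fun h => hW (mem_posDefHermitian_of_hermBlock h),
                zero_mul]
            rw [gramDensity, Set.indicator_of_notMem hW]
            simp [h0]
      _ = _ := by
          rw [lintegral_const_mul' _ _ ENNReal.ofReal_ne_top, ← mul_assoc,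
            ← ENNReal.ofReal_mul' hc, lintegral_hermitianMeasure_succ hg, stiefelMass_succ]
          congr 2
          rw [pow_succ]
          ring

end Gram

/-! ### Polar integration -/

section Polar

/-- A compact group is unimodular: Haar measure, left invariant by construction, is right
invariant. -/
theorem lintegral_haarMeasure_mul_right {G : Type*} [Group G] [TopologicalSpace G]
    [IsTopologicalGroup G] [CompactSpace G] [SecondCountableTopology G] [T2Space G]
    [MeasurableSpace G] [BorelSpace G] (φ : G → ENNReal) (g : G) :
    ∫⁻ k, φ (k * g) ∂(Measure.haarMeasure (⊤ : TopologicalSpace.PositiveCompacts G)) =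
      ∫⁻ k, φ k ∂(Measure.haarMeasure (⊤ : TopologicalSpace.PositiveCompacts G)) := by
  set μ := Measure.haarMeasure (⊤ : TopologicalSpace.PositiveCompacts G)
  have h1 : μ Set.univ = 1 := Measure.haarMeasure_self (K₀ := ⊤)
  have hp : IsProbabilityMeasure μ := ⟨h1⟩
  have hmap : Measure.map (· * g) μ = μ := by
    have h := Measure.isMulInvariant_eq_smul_of_compactSpace (Measure.map (· * g) μ) μ
    have h2 := congrArg (fun ν => ν Set.univ) h
    rw [h]
    simp only [Measure.smul_apply, h1,
      Measure.map_apply (measurable_mul_const g) MeasurableSet.univ, Set.preimage_univ] at h2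
    have h3 : Measure.haarScalarFactor (Measure.map (· * g) μ) μ = 1 := by
      rw [ENNReal.smul_def, smul_eq_mul, mul_one] at h2
      exact_mod_cast h2.symm
    rw [h3, one_smul]
  conv_rhs => rw [← hmap]
  exact (lintegral_map_equiv φ (MeasurableEquiv.mulRight g)).symm

variable {F : Type*} [NormedDivisionRing F] [NormedAlgebra ℝ F] [StarRing F] [ConjNorm F]
  [ContinuousStar F] [ProperSpace F] [MeasureSpace F] [BorelSpace F] [LebesgueVolume F]

omit [LebesgueVolume F] in
/-- The square root is measurable, being the inverse of an injective measurable map between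
standard Borel spaces. -/
theorem measurable_hermitianSqrt {N : ℕ} :
    Measurable (hermitianSqrt : Matrix (Fin N) (Fin N) F → Matrix (Fin N) (Fin N) F) := by
  have := finiteDimensional_of_proper F
  have hP : PolishSpace (posHermitian F N) := isClosed_posHermitian.polishSpace
  let sq : posHermitian F N → Matrix (Fin N) (Fin N) F := fun P => P.1 * P.1
  have hsq : MeasurableEmbedding sq := by
    have hc : Continuous sq := continuous_subtype_val.matrix_mul continuous_subtype_val
    refine hc.measurable.measurableEmbedding fun P Q h => Subtype.ext ?_
    exact posHermitian_mul_self_injective P.2 Q.2 h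
  have e : (hermitianSqrt : Matrix (Fin N) (Fin N) F → Matrix (Fin N) (Fin N) F) =
      Function.extend sq Subtype.val 0 := by
    funext W
    by_cases hW : W ∈ posHermitian F N
    · obtain ⟨P, hP, rfl⟩ := exists_posHermitian_mul_self hW
      rw [hermitianSqrt_eq hP]
      exact (hsq.injective.extend_apply Subtype.val 0 ⟨P, hP⟩).symm
    · rw [Function.extend_apply', hermitianSqrt, dif_neg]
      · rfl
      · rintro ⟨P, hP, rfl⟩
        exact hW (mul_self_mem_posHermitian hP)
      · rintro ⟨P, rfl⟩
        exact hW (mul_self_mem_posHermitian P.2)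
  rw [e]
  exact hsq.measurable_extend measurable_subtype_coe measurable_const

instance instSecondCountableTopologyUnitary (n : ℕ) : SecondCountableTopology (unitaryGrp F n) :=
  TopologicalSpace.Subtype.secondCountableTopology
    (unitaryGrp F n : Set (Matrix (Fin n) (Fin n) F))

omit [NormedAlgebra ℝ F] [ConjNorm F] [ContinuousStar F] [ProperSpace F] [MeasureSpace F]
  [BorelSpace F] [LebesgueVolume F] in
theorem firstColumns_mul {n N : ℕ} (h : N ≤ n) (k k' : unitaryGrp F n) :
    (firstColumns h (k * k') : Matrix (Fin n) (Fin N) F) =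
      (k : Matrix (Fin n) (Fin n) F) * (firstColumns h k' : Matrix (Fin n) (Fin N) F) := by
  ext i j
  rfl

omit [NormedAlgebra ℝ F] [ConjNorm F] [ContinuousStar F] [LebesgueVolume F] in
theorem measurable_firstColumns {n N : ℕ} (h : N ≤ n) :
    Measurable (firstColumns h : unitaryGrp F n → stiefel F n N) := by
  refine Measurable.subtype_mk (Continuous.measurable ?_)
  exact continuous_subtype_val.matrix_submatrix _ _

/-- The parametrisation `(U, W) ↦ U W ^ (1/2)` of the `n × N` matrices. -/
def polarMap (F : Type*) [NormedDivisionRing F] [NormedAlgebra ℝ F] [StarRing F] (n N : ℕ)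
    (p : stiefel F n N × Matrix (Fin N) (Fin N) F) : Matrix (Fin n) (Fin N) F :=
  (p.1 : Matrix (Fin n) (Fin N) F) * hermitianSqrt p.2

omit [NormedAlgebra ℝ F] [StarRing F] [ConjNorm F] [ContinuousStar F] [LebesgueVolume F] in
theorem measurable_matrix_mul {m n k : ℕ} :
    Measurable fun p : Matrix (Fin m) (Fin n) F × Matrix (Fin n) (Fin k) F => p.1 * p.2 :=
  (continuous_fst.matrix_mul continuous_snd).measurable

omit [LebesgueVolume F] in
theorem measurable_polarMap {n N : ℕ} : Measurable (polarMap F n N) :=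
  measurable_matrix_mul.comp ((measurable_subtype_coe.comp measurable_fst).prodMk
    (measurable_hermitianSqrt.comp measurable_snd))

instance instIsProbabilityMeasureHaar (n : ℕ) : IsProbabilityMeasure
    (Measure.haarMeasure (⊤ : TopologicalSpace.PositiveCompacts (unitaryGrp F n))) :=
  ⟨Measure.haarMeasure_self (K₀ := ⊤)⟩

/-- Averaging over the unitary group: it acts transitively on the matrices with given Gram
matrix. -/
theorem lintegral_matrixMeasure_eq_average {n N : ℕ} (h : N ≤ n)
    {G : Matrix (Fin n) (Fin N) F → ENNReal} (hG : Measurable G) :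
    ∫⁻ M, G M ∂(matrixMeasure F n N) = ∫⁻ M, (∫⁻ k, G (polarMap F n N (firstColumns h k, Mᴴ * M))
      ∂(Measure.haarMeasure (⊤ : TopologicalSpace.PositiveCompacts (unitaryGrp F n))))
      ∂(matrixMeasure F n N) := by
  have := finiteDimensional_of_proper F
  set ν := Measure.haarMeasure (⊤ : TopologicalSpace.PositiveCompacts (unitaryGrp F n))
  have hmeas : Measurable fun p : unitaryGrp F n × Matrix (Fin n) (Fin N) F =>
      G ((p.1 : Matrix (Fin n) (Fin n) F) * p.2) :=
    hG.comp (measurable_matrix_mul.comp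
      ((measurable_subtype_coe.comp measurable_fst).prodMk measurable_snd))
  calc ∫⁻ M, G M ∂(matrixMeasure F n N)
      = ∫⁻ k, (∫⁻ M, G ((k : Matrix (Fin n) (Fin n) F) * M) ∂(matrixMeasure F n N)) ∂ν := by
        have h1 : ∀ k : unitaryGrp F n,
            ∫⁻ M, G ((k : Matrix (Fin n) (Fin n) F) * M) ∂(matrixMeasure F n N) =
              ∫⁻ M, G M ∂(matrixMeasure F n N) := fun k =>
          (measurePreserving_mul_left (Unitary.mem_iff.1 k.2).1).lintegral_comp hG
        simp only [h1, lintegral_const, measure_univ, mul_one]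
    _ = ∫⁻ M, (∫⁻ k, G ((k : Matrix (Fin n) (Fin n) F) * M) ∂ν) ∂(matrixMeasure F n N) :=
        lintegral_lintegral_swap hmeas.aemeasurable
    _ = _ := by
        refine lintegral_congr fun M => ?_
        obtain ⟨U, hU⟩ := exists_polar h M
        obtain ⟨k', rfl⟩ := exists_firstColumns_eq h U
        rw [← lintegral_haarMeasure_mul_right
          (fun k => G (polarMap F n N (firstColumns h k, Mᴴ * M))) k']
        refine lintegral_congr fun k => ?_
        rw [polarMap, firstColumns_mul, Matrix.mul_assoc, ← hU]

instance instIsFiniteMeasureStiefel {n N : ℕ} (h : N ≤ n) :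
    IsFiniteMeasure (stiefelMeasure F h) := by
  unfold stiefelMeasure
  exact Measure.smul_finite _ ENNReal.ofReal_ne_top

/-- The integration formula for non-negative functions. -/
theorem lintegral_polar {n N : ℕ} (h : N ≤ n) {G : Matrix (Fin n) (Fin N) F → ENNReal}
    (hG : Measurable G) :
    ∫⁻ M, G M ∂(matrixMeasure F n N) = ENNReal.ofReal ((2 : ℝ) ^ N)⁻¹ *
      ∫⁻ p, gramDensity F n N p.2 * G (polarMap F n N p)
        ∂((stiefelMeasure F h).prod ((hermitianMeasure F N).restrict (posHermitian F N))) := by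
  have := finiteDimensional_of_proper F
  set ν := Measure.haarMeasure (⊤ : TopologicalSpace.PositiveCompacts (unitaryGrp F n)) with hν
  have hGp : Measurable fun p => G (polarMap F n N p) := hG.comp measurable_polarMap
  have hm1 : Measurable fun p : unitaryGrp F n × Matrix (Fin N) (Fin N) F =>
      G (polarMap F n N (firstColumns h p.1, p.2)) :=
    hGp.comp (((measurable_firstColumns h).comp measurable_fst).prodMk measurable_snd)
  have hH : Measurable fun W : Matrix (Fin N) (Fin N) F =>
      ∫⁻ k, G (polarMap F n N (firstColumns h k, W)) ∂ν := hm1.lintegral_prod_left'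
  have hm2 : Measurable fun p : stiefel F n N × Matrix (Fin N) (Fin N) F =>
      gramDensity F n N p.2 * G (polarMap F n N p) :=
    (measurable_gramDensity.comp measurable_snd).mul hGp
  have hinner : ∀ W : Matrix (Fin N) (Fin N) F,
      ∫⁻ U, gramDensity F n N W * G (polarMap F n N (U, W)) ∂(stiefelMeasure F h) =
        ENNReal.ofReal (stiefelMass F n N) *
          (gramDensity F n N W * ∫⁻ k, G (polarMap F n N (firstColumns h k, W)) ∂ν) := fun W => by
    have hw : Measurable fun U => G (polarMap F n N (U, W)) :=
      hGp.comp (measurable_id.prodMk measurable_const)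
    rw [lintegral_const_mul _ hw, stiefelMeasure, lintegral_smul_measure,
      lintegral_map hw (measurable_firstColumns h), smul_eq_mul, mul_left_comm]
  rw [lintegral_matrixMeasure_eq_average h hG, lintegral_gram h hH, lintegral_prod_symm' _ hm2]
  simp only [hinner]
  rw [lintegral_const_mul' _ _ ENNReal.ofReal_ne_top, ← mul_assoc,
    ← ENNReal.ofReal_mul (by positivity), div_eq_inv_mul, ← lintegral_indicator
    measurableSet_posHermitian]
  congr 1
  refine lintegral_congr fun W => ?_
  by_cases hW : W ∈ posHermitian F N
  · rw [Set.indicator_of_mem hW]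
  · rw [Set.indicator_of_notMem hW, gramDensity_eq_zero hW, zero_mul]

/-- Lebesgue measure on matrices is the image of the weighted product measure under the polar
parametrisation. -/
theorem matrixMeasure_eq_map {n N : ℕ} (h : N ≤ n) :
    matrixMeasure F n N = ENNReal.ofReal ((2 : ℝ) ^ N)⁻¹ • Measure.map (polarMap F n N)
      (((stiefelMeasure F h).prod ((hermitianMeasure F N).restrict (posHermitian F N))).withDensity
        fun p => gramDensity F n N p.2) := by
  refine Measure.ext_of_lintegral _ fun G hG => ?_
  have hδ : Measurable fun p : stiefel F n N × Matrix (Fin N) (Fin N) F =>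
      gramDensity F n N p.2 := measurable_gramDensity.comp measurable_snd
  have hGp : Measurable fun p => G (polarMap F n N p) := hG.comp measurable_polarMap
  rw [lintegral_polar h hG, lintegral_smul_measure, lintegral_map hG measurable_polarMap,
    lintegral_withDensity_eq_lintegral_mul _ hδ hGp]
  rfl

/-- The polar decomposition and the integration formula over all `F` with Lebesgue measure. -/
theorem polarIntegration {n N : ℕ} (h : N ≤ n) : PolarIntegration F h := by
  have := finiteDimensional_of_proper F
  refine ⟨fun M => ⟨conjTranspose_mul_self_mem_posHermitian M, exists_polar h M⟩, fun g hg => ?_⟩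
  set ρ := (hermitianMeasure F N).restrict (posHermitian F N) with hρ
  set w : Matrix (Fin N) (Fin N) F → ℝ := fun W =>
    hermitianDet W ^ ((beta F : ℝ) * ((n : ℝ) - (N : ℝ) + 1) / 2 - 1) with hw
  set τ := ((stiefelMeasure F h).prod ρ).withDensity fun p => gramDensity F n N p.2 with hτ
  have hδ : Measurable fun p : stiefel F n N × Matrix (Fin N) (Fin N) F =>
      gramDensity F n N p.2 := measurable_gramDensity.comp measurable_snd
  have hδ' : ∀ᵐ p ∂((stiefelMeasure F h).prod ρ), gramDensity F n N p.2 < ⊤ :=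
    Filter.Eventually.of_forall fun p => gramDensity_lt_top p.2
  -- The two weights may differ at singular matrices, which form a null set.
  have hae : ∀ᵐ W ∂ρ, (gramDensity F n N W).toReal = w W := by
    have h0 : ∀ᵐ W ∂(hermitianMeasure F N), W ∉ posHermitian F N \ posDefHermitian F N :=
      measure_eq_zero_iff_ae_notMem.1 (hermitianMeasure_singular N)
    rw [hρ, ae_restrict_iff' measurableSet_posHermitian]
    filter_upwards [h0] with W hW hpos
    refine toReal_gramDensity ?_
    by_contra hc
    exact hW ⟨hpos, hc⟩
  have hae2 : ∀ᵐ p ∂((stiefelMeasure F h).prod ρ),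
      (gramDensity F n N p.2).toReal • g (polarMap F n N p) = w p.2 * g (polarMap F n N p) := by
    filter_upwards [Measure.quasiMeasurePreserving_snd.ae hae] with p hp
    rw [hp, smul_eq_mul]
  have hmap := matrixMeasure_eq_map (F := F) h
  have hc0 : ENNReal.ofReal ((2 : ℝ) ^ N)⁻¹ ≠ 0 := by
    rw [ENNReal.ofReal_ne_zero_iff]; positivity
  have hg1 : Integrable g (Measure.map (polarMap F n N) τ) := by
    rw [hmap] at hg
    exact (integrable_smul_measure hc0 ENNReal.ofReal_ne_top).1 hg
  have hg2 : Integrable (fun p => g (polarMap F n N p)) τ :=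
    hg1.comp_measurable measurable_polarMap
  have hg3 : Integrable (fun p : stiefel F n N × Matrix (Fin N) (Fin N) F =>
      w p.2 * g (polarMap F n N p)) ((stiefelMeasure F h).prod ρ) := by
    rw [hτ, integrable_withDensity_iff_integrable_smul' hδ hδ'] at hg2
    exact hg2.congr hae2
  refine ⟨hg3, ?_⟩
  calc ∫ M, g M ∂(matrixMeasure F n N)
      = ((2 : ℝ) ^ N)⁻¹ * ∫ p, g (polarMap F n N p) ∂τ := by
        rw [hmap, integral_smul_measure, ENNReal.toReal_ofReal (by positivity), smul_eq_mul,
          integral_map measurable_polarMap.aemeasurable hg1.aestronglyMeasurable]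
    _ = ((2 : ℝ) ^ N)⁻¹ * ∫ p, w p.2 * g (polarMap F n N p) ∂((stiefelMeasure F h).prod ρ) := by
        rw [hτ, integral_withDensity_eq_integral_toReal_smul hδ hδ', integral_congr_ae hae2]
    _ = _ := by
        rw [integral_prod _ hg3]
        rfl

end Polar

/-! ### The measures of the real, complex and quaternion scalars -/

section Instances

theorem integral_rexp_neg_norm_sq (V : Type*) [NormedAddCommGroup V] [InnerProductSpace ℝ V]
    [FiniteDimensional ℝ V] [MeasurableSpace V] [BorelSpace V] :
    ∫ a : V, Real.exp (-‖a‖ ^ 2) = Real.pi ^ ((Module.finrank ℝ V : ℝ) / 2) := by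
  simpa using GaussianFourier.integral_rexp_neg_mul_sq_norm (V := V) one_pos

instance instLebesgueVolumeReal : LebesgueVolume ℝ where
  isAddHaarMeasure := inferInstance
  integral_gaussian := integral_rexp_neg_norm_sq ℝ

instance instLebesgueVolumeComplex : LebesgueVolume ℂ where
  isAddHaarMeasure := inferInstance
  integral_gaussian := integral_rexp_neg_norm_sq ℂ

instance instLebesgueVolumeQuaternion : LebesgueVolume ℍ[ℝ] where
  isAddHaarMeasure := inferInstance
  integral_gaussian := integral_rexp_neg_norm_sq ℍ[ℝ]

end Instances

end MatrixPolar

end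

theorem mainTheorem1 (n N : ℕ) (h : N ≤ n) :
    MatrixPolar.PolarIntegration ℝ h ∧
    MatrixPolar.PolarIntegration ℂ h ∧
    MatrixPolar.PolarIntegration ℍ[ℝ] h :=
  ⟨MatrixPolar.polarIntegration h, MatrixPolar.polarIntegration h, MatrixPolar.polarIntegration h⟩
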